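/- Let $(\Omega,\mathcal A,\mathbf P)$ be a probability space carrying an $m$-dimensional two-sided Brownian motion $W=(W^1,\dots,W^m)$, i.e. $W^1,\dots,W^m$ are independent and each $W^j$ is given by $W^j_t=W^{j,(1)}_t$ for $t\ge 0$ and $W^j_t=W^{j,(2)}_{-t}$ for $t<0$, with two independent standard Brownian motions $W^{j,(1)},W^{j,(2)}$ on $[0,\infty)$. For $H\in(0,1)$, $t\ge 0$, $s\in\mathbb R$ put $$C_H=\frac{\sqrt{\sin(\pi H)\Gamma(2H+1)}}{\Gamma(H+1/2)},\qquad K_H(s,t)=\big(|t-s|^{H-1/2}-|s|^{H-1/2}\big)\mathbf 1_{(-\infty,0)}(s)+|t-s|^{H-1/2}\mathbf 1_{[0,t)}(s).$$ A Mandelbrot--van Ness fractional Brownian motion driven by $W$ is a family of $\mathbb R^m$-valued random variables $B^H_t$, $H\in(0,1)$, $t\ge0$, such that $B^{H,j}_t=C_H\int_{\mathbb R}K_H(s,t)\,\mathrm dW^j_s$ almost surely (Wiener integral) for all fixed $H,t,j$, and $(H,t)\mapsto B^H_t(\omega)$ is continuous on $(0,1)\times[0,\infty)$ for every $\omega\in\Omega$.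 For $\mu\colon\mathbb R^d\to\mathbb R^d$, $\Sigma\in\mathbb R^{d\times m}$ and $x_0\in\mathbb R^d$ consider, for every $\omega$ and every $H\in(0,1)$, the continuous solution $X^H=X^H(\omega)$ of $$X^H_t=x_0+\int_0^t\mu(X^H_s)\,\mathrm ds+\Sigma B^H_t,\qquad t\ge0.$$ (i) There is a Mandelbrot--van Ness fractional Brownian motion $B$ driven by $W$ of the form $$B^H_t(\omega)=B^{1/2}_t(\omega)+\int_{1/2}^H D^h_t(\omega)\,\mathrm dh,\qquad H\in(0,1),\ t\ge0,\ \omega\in\Omega,$$ where $(h,t)\mapsto D^h_t(\omega)$ is continuous on $(0,1)\times[0,\infty)$ for every $\omega$ (so that $D^h=\partial_hB^h$), for which the following holds. For every $d$, every globally Lipschitz continuous $\mu\colon\mathbb R^d\to\mathbb R^d$, every $\Sigma\in\mathbb R^{d\times m}$, every $[a,b]\subset(0,1)$ and every $T>0$ there is a non-negative (finite) random variable $K_{a,b,T}$ (depending also on $\mu$ and $\Sigma$, but not on $x_0$) such that for all $x_0\in\mathbb R^d$ and all $\omega\in\Omega$ $$\sup_{t\in[0,T]}\|X^{H_1}_t-X^{H_2}_t\|\le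 K_{a,b,T}\,|H_1-H_2|\qquad\text{for all }H_1,H_2\in[a,b].$$ (ii) For an arbitrary Mandelbrot--van Ness fractional Brownian motion $B$ driven by $W$, the same holds with "for all $\omega\in\Omega$" replaced by "for almost all $\omega\in\Omega$" (with one null set for all $H_1,H_2\in[a,b]$, which may depend on $x_0$). -/

import Mathlib

open MeasureTheory ProbabilityTheory Filter Topology
open scoped NNReal ENNReal Matrix

/-! ### Two-sided Brownian motion -/

/-- `B` is a two-sided Brownian motion: `B t = W₁ t` for `t ≥ 0` and `B t = W₂ (-t)` for `t < 0`,
where `W₁`, `W₂` are two independent standard Brownian motions indexed by `[0, ∞)`. -/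
def IsTwoSidedBM {Ω : Type*} [MeasurableSpace Ω] (B : ℝ → Ω → ℝ) (P : Measure Ω) : Prop :=
  ∃ W₁ W₂ : ℝ≥0 → Ω → ℝ,
    IsBrownianReal W₁ P ∧ IsBrownianReal W₂ P ∧
    IndepFun (fun ω (t : ℝ≥0) => W₁ t ω) (fun ω (t : ℝ≥0) => W₂ t ω) P ∧
    (∀ t : ℝ, 0 ≤ t → B t = W₁ t.toNNReal) ∧
    (∀ t : ℝ, t < 0 → B t = W₂ (-t).toNNReal)

/-- `W` is an `m`-dimensional two-sided Brownian motion: its components are independent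
two-sided Brownian motions. -/
structure IsTwoSidedBMVector {Ω : Type*} [MeasurableSpace Ω] {m : ℕ}
    (W : Fin m → ℝ → Ω → ℝ) (P : Measure Ω) : Prop where
  isBM : ∀ j, IsTwoSidedBM (W j) P
  indep : iIndepFun (fun (j : Fin m) ω (t : ℝ) => W j t ω) P

/-! ### The Wiener integral of a square integrable deterministic function -/

/-- A step function `∑ i, coef i * 1_{(left i, right i]}` on the real line. -/
structure StepIntegrand where
  n : ℕ
  coef : Fin n → ℝ
  left : Fin n → ℝ
  right : Fin n → ℝ
  le : ∀ i, left i ≤ right i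

/-- The step function as a function on the real line. -/
noncomputable def StepIntegrand.toFun (φ : StepIntegrand) (s : ℝ) : ℝ :=
  ∑ i, φ.coef i * (Set.Ioc (φ.left i) (φ.right i)).indicator (fun _ => (1 : ℝ)) s

/-- The stochastic integral `∫ φ dB = ∑ i, coef i * (B (right i) - B (left i))`. -/
noncomputable def StepIntegrand.integral {Ω : Type*} (φ : StepIntegrand) (B : ℝ → Ω → ℝ)
    (ω : Ω) : ℝ :=
  ∑ i, φ.coef i * (B (φ.right i) ω - B (φ.left i) ω)

/-- `Y = ∫ f(s) dB_s` (a Wiener integral, determined up to almost sure equality):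
`f ∈ L²(ℝ)`, `Y ∈ L²(P)`, and for some step functions `φ k → f` in `L²(ℝ)` the integrals
`∫ φ k dB` converge to `Y` in `L²(P)`. -/
def IsWienerIntegral {Ω : Type*} [MeasurableSpace Ω] (B : ℝ → Ω → ℝ) (P : Measure Ω)
    (f : ℝ → ℝ) (Y : Ω → ℝ) : Prop :=
  MemLp f 2 volume ∧ MemLp Y 2 P ∧
  ∃ φ : ℕ → StepIntegrand,
    Tendsto (fun k => eLpNorm (fun s => (φ k).toFun s - f s) 2 volume) atTop (𝓝 0) ∧
    Tendsto (fun k => eLpNorm (fun ω => (φ k).integral B ω - Y ω) 2 P) atTop (𝓝 0)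

/-! ### The Mandelbrot–van Ness fractional Brownian motion -/

/-- The constant `C_H = √(sin(πH) Γ(2H+1)) / Γ(H+1/2)`. -/
noncomputable def mvnConst (H : ℝ) : ℝ :=
  Real.sqrt (Real.sin (Real.pi * H) * Real.Gamma (2 * H + 1)) / Real.Gamma (H + 1 / 2)

/-- The kernel
`K_H(s,t) = (|t-s|^(H-1/2) - |s|^(H-1/2)) 1_{(-∞,0)}(s) + |t-s|^(H-1/2) 1_{[0,t)}(s)`, `t ≥ 0`. -/
noncomputable def mvnKernel (H s t : ℝ) : ℝ :=
  (Set.Iio (0 : ℝ)).indicator (fun s => |t - s| ^ (H - 1 / 2) - |s| ^ (H - 1 / 2)) s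
    + (Set.Ico (0 : ℝ) t).indicator (fun s => |t - s| ^ (H - 1 / 2)) s

/-- `B H t`, for `H ∈ (0,1)` and `t ≥ 0`, is the `m`-dimensional Mandelbrot–van Ness fractional
Brownian motion with Hurst parameter `H` driven by `W`: componentwise
`B^{H,j}_t = C_H ∫ K_H(s,t) dW^j_s` almost surely, for every fixed `H` and `t`, and the version is
such that `(H,t) ↦ B^H_t(ω)` is continuous for every `ω`. -/
structure IsMvNfBm {Ω : Type*} [MeasurableSpace Ω] {m : ℕ} (W : Fin m → ℝ → Ω → ℝ)
    (P : Measure Ω) (B : ℝ → ℝ → Ω → EuclideanSpace ℝ (Fin m)) : Prop where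
  measurable : ∀ H ∈ Set.Ioo (0 : ℝ) 1, ∀ t : ℝ, 0 ≤ t → Measurable (B H t)
  eq_integral : ∀ H ∈ Set.Ioo (0 : ℝ) 1, ∀ t : ℝ, 0 ≤ t → ∀ j : Fin m,
    ∃ Y : Ω → ℝ, IsWienerIntegral (W j) P (fun s => mvnKernel H s t) Y ∧
      ∀ᵐ ω ∂P, B H t ω j = mvnConst H * Y ω
  continuous : ∀ ω, ContinuousOn (fun p : ℝ × ℝ => B p.1 p.2 ω)
    (Set.Ioo (0 : ℝ) 1 ×ˢ Set.Ici (0 : ℝ))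

/-! ### The equation with additive noise -/

/-- The path `x` is a (continuous) solution of `x_t = x₀ + ∫_0^t μ(x_s) ds + S g_t`, `t ≥ 0`. -/
def IsAdditiveSolution {d m : ℕ}
    (μ : EuclideanSpace ℝ (Fin d) → EuclideanSpace ℝ (Fin d)) (S : Matrix (Fin d) (Fin m) ℝ)
    (x₀ : EuclideanSpace ℝ (Fin d)) (g : ℝ → EuclideanSpace ℝ (Fin m))
    (x : ℝ → EuclideanSpace ℝ (Fin d)) : Prop :=
  ContinuousOn x (Set.Ici (0 : ℝ)) ∧
  ∀ t : ℝ, 0 ≤ t → x t = x₀ + (∫ s in (0 : ℝ)..t, μ (x s)) + Matrix.toEuclideanLin S (g t)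

/-!
The proof is pathwise. Put `α = H - 1/2 ∈ (-1/2, 1/2)`. For almost every `s`, the kernel is a
superposition of indicators of intervals,
`K_H(s, t) = 1_{(0, t]} + α ∫_0^1 u^(α-1) (1_{(-u, 0]} - 1_{(t-u, t]}) du
  + α (1-α) ∫_{u > 1} ∫_{0 < v ≤ t} u^(α-2) 1_{(v-u, v-1]} dv du`,
where the first integral accounts for the singularities at `0` and `t` and the second one for the
tail at `-∞`. Integrating against `dW` (`isWienerIntegral_mvnPath`) replaces each indicator
`1_{(a, b]}` by `W_b - W_a` and gives the functional `mvnPath` of the Brownian path. The exchange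
of integrals is the stochastic Fubini theorem `isWienerIntegral_integral`: the closure of the graph
of the elementary integral in `L²(ℝ) × L²(P)` is a closed subspace, so it contains Bochner integrals
of its elements, and these are computed pointwise. By the Wiener isometry the closed graph also
gives uniqueness of the integral (`IsWienerIntegral.ae_eq`).

The parameter `H` enters `mvnPath` only through powers `u ^ α` integrated against increments of the
path. If the path is Hölder continuous of every order below `1/2` and its increments have integrable
tails (`IsRegularPath`), dominated convergence shows that `mvnPath` is differentiable in `α`, with a
derivative that is jointly continuous in `(α, t)`. Almost every Brownian path is regular
(`ae_isRegularPath`): the Hölder property follows by dyadic chaining from Gaussian moments, and the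
tails have finite mean. Replacing the remaining paths by zero gives a version `B` of fractional
Brownian motion that is continuously differentiable in `H` for every `ω`
(`exists_isMvNfBm_differentiable`).

The estimate for the solutions is then Gronwall's inequality with the constant
`exp ((L + 1) T) ‖Σ‖ sup ‖∂_H B‖` (`exists_lipschitz_constant`). Any other Mandelbrot–van Ness
fractional Brownian motion is indistinguishable from `B` (`IsMvNfBm.ae_eq`), so the same constant
works for it almost surely.
-/

/-! ### The closed graph of the Wiener integral -/

/-- The signed indicator of the interval between `0` and `s`, so that
`1_{(a, b]} = brownianIndicator b - brownianIndicator a` for `a ≤ b`. -/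
noncomputable def brownianIndicator (s x : ℝ) : ℝ :=
  (Set.Ioc 0 s).indicator (fun _ => (1 : ℝ)) x - (Set.Ioc s 0).indicator (fun _ => (1 : ℝ)) x

lemma brownianIndicator_sub {a b : ℝ} (h : a ≤ b) (x : ℝ) :
    brownianIndicator b x - brownianIndicator a x
      = (Set.Ioc a b).indicator (fun _ => (1 : ℝ)) x := by
  simp only [brownianIndicator, Set.indicator_apply, Set.mem_Ioc]
  grind

lemma memLp_indicator_Ioc (a b : ℝ) :
    MemLp ((Set.Ioc a b).indicator (fun _ => (1 : ℝ))) 2 volume :=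
  memLp_indicator_const 2 measurableSet_Ioc 1 (Or.inr (by simp))

lemma memLp_brownianIndicator (s : ℝ) : MemLp (brownianIndicator s) 2 volume :=
  (memLp_indicator_Ioc 0 s).sub (memLp_indicator_Ioc s 0)

/-- The second order structure of a two-sided Brownian motion: `V` is a square integrable process
with `E[V_s V_t] = ⟨1_{(0, s]}, 1_{(0, t]}⟩` in `L²(ℝ)`, with signed indicators for negative
times. -/
structure HasBrownianCovariance {Ω : Type*} [MeasurableSpace Ω] (V : ℝ → Ω → ℝ)
    (P : Measure Ω) : Prop where
  memLp : ∀ t, MemLp (V t) 2 P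
  covariance : ∀ s t, ∫ ω, V s ω * V t ω ∂P = ∫ x, brownianIndicator s x * brownianIndicator t x

section WienerIntegral

variable {Ω : Type*} [MeasurableSpace Ω] {P : Measure Ω} {V : ℝ → Ω → ℝ}

/-- The pair `(1_{(0, s]}, V_s)` in `L²(ℝ) × L²(P)`. -/
noncomputable def wienerPair (hV : HasBrownianCovariance V P) (s : ℝ) :
    Lp ℝ 2 (volume : Measure ℝ) × Lp ℝ 2 P :=
  ((memLp_brownianIndicator s).toLp _, (hV.memLp s).toLp _)

/-- The graph of the elementary Wiener integral: the span in `L²(ℝ) × L²(P)` of the pairs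
`(1_{(a, b]}, V_b - V_a)`. -/
noncomputable def elementaryGraph (hV : HasBrownianCovariance V P) :
    Submodule ℝ (Lp ℝ 2 (volume : Measure ℝ) × Lp ℝ 2 P) :=
  Submodule.span ℝ {p | ∃ a b, a ≤ b ∧ p = wienerPair hV b - wienerPair hV a}

lemma wienerPair_fst_sub (hV : HasBrownianCovariance V P) {a b : ℝ} (h : a ≤ b) :
    (wienerPair hV b - wienerPair hV a).1 = (memLp_indicator_Ioc a b).toLp _ := by
  rw [Prod.fst_sub, wienerPair, wienerPair, ← MemLp.toLp_sub]
  congr 1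
  funext x
  exact brownianIndicator_sub h x

lemma inner_wienerPair (hV : HasBrownianCovariance V P) (s t : ℝ) :
    inner ℝ (wienerPair hV s).1 (wienerPair hV t).1
      = inner ℝ (wienerPair hV s).2 (wienerPair hV t).2 := by
  rw [L2.inner_def, L2.inner_def]
  have h1 : ∫ x, inner ℝ ((wienerPair hV s).1 x) ((wienerPair hV t).1 x)
      = ∫ x, brownianIndicator s x * brownianIndicator t x := by
    refine integral_congr_ae ?_
    filter_upwards [(memLp_brownianIndicator s).coeFn_toLp, (memLp_brownianIndicator t).coeFn_toLp]
      with x h1 h2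
    simp only [wienerPair, h1, h2]
    simp [mul_comm]
  have h2 : ∫ x, inner ℝ ((wienerPair hV s).2 x) ((wienerPair hV t).2 x) ∂P
      = ∫ x, V s x * V t x ∂P := by
    refine integral_congr_ae ?_
    filter_upwards [(hV.memLp s).coeFn_toLp, (hV.memLp t).coeFn_toLp] with x h1 h2
    simp only [wienerPair, h1, h2]
    simp [mul_comm]
  rw [h1, h2, hV.covariance]

lemma norm_fst_eq_norm_snd_of_mem_span (hV : HasBrownianCovariance V P)
    {p : Lp ℝ 2 (volume : Measure ℝ) × Lp ℝ 2 P}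
    (hp : p ∈ Submodule.span ℝ (Set.range (wienerPair hV))) : ‖p.1‖ = ‖p.2‖ := by
  have key : ∀ {p q : Lp ℝ 2 (volume : Measure ℝ) × Lp ℝ 2 P},
      p ∈ Submodule.span ℝ (Set.range (wienerPair hV)) →
      q ∈ Submodule.span ℝ (Set.range (wienerPair hV)) →
      inner ℝ p.1 q.1 = inner ℝ p.2 q.2 := by
    intro p q hp hq
    induction hp, hq using Submodule.span_induction₂ with
    | mem_mem x y hx hy =>
      obtain ⟨s, rfl⟩ := hx
      obtain ⟨t, rfl⟩ := hy
      exact inner_wienerPair hV s t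
    | zero_left y hy => simp
    | zero_right x hx => simp
    | add_left x y z _ _ _ h1 h2 => simp [inner_add_left, h1, h2]
    | add_right x y z _ _ _ h1 h2 => simp [inner_add_right, h1, h2]
    | smul_left r x y _ _ h => simp [inner_smul_left, h]
    | smul_right r x y _ _ h => simp [inner_smul_right, h]
  have := key hp hp
  rw [real_inner_self_eq_norm_sq, real_inner_self_eq_norm_sq] at this
  exact (sq_eq_sq₀ (norm_nonneg _) (norm_nonneg _)).1 this

lemma elementaryGraph_le (hV : HasBrownianCovariance V P) :
    elementaryGraph hV ≤ Submodule.span ℝ (Set.range (wienerPair hV)) := by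
  refine Submodule.span_le.2 ?_
  rintro _ ⟨a, b, -, rfl⟩
  exact Submodule.sub_mem _ (Submodule.subset_span ⟨b, rfl⟩) (Submodule.subset_span ⟨a, rfl⟩)

/-- The Wiener isometry, on the closure of the graph of the elementary integral. -/
lemma norm_fst_eq_norm_snd (hV : HasBrownianCovariance V P)
    {p : Lp ℝ 2 (volume : Measure ℝ) × Lp ℝ 2 P}
    (hp : p ∈ (elementaryGraph hV).topologicalClosure) : ‖p.1‖ = ‖p.2‖ := by
  have hc : IsClosed {p : Lp ℝ 2 (volume : Measure ℝ) × Lp ℝ 2 P | ‖p.1‖ = ‖p.2‖} :=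
    isClosed_eq (by fun_prop) (by fun_prop)
  exact closure_minimal (fun q hq => norm_fst_eq_norm_snd_of_mem_span hV
    (elementaryGraph_le hV hq)) hc hp

lemma norm_wienerPair_sub_fst (hV : HasBrownianCovariance V P) {a b : ℝ} (h : a ≤ b) :
    ‖(wienerPair hV b - wienerPair hV a).1‖ = √(b - a) := by
  rw [wienerPair_fst_sub hV h, Lp.norm_toLp, eLpNorm_indicator_const measurableSet_Ioc
    (by simp) (by simp)]
  simp only [enorm_one, Real.volume_Ioc, one_mul]
  rw [← ENNReal.toReal_rpow, ENNReal.toReal_ofReal (by linarith), Real.sqrt_eq_rpow]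
  simp

lemma norm_wienerPair_sub (hV : HasBrownianCovariance V P) {a b : ℝ} (h : a ≤ b) :
    ‖wienerPair hV b - wienerPair hV a‖ = √(b - a) := by
  have h2 := norm_fst_eq_norm_snd hV ((elementaryGraph hV).le_topologicalClosure
    (Submodule.subset_span ⟨a, b, h, rfl⟩))
  rw [Prod.norm_def, ← h2, max_self, norm_wienerPair_sub_fst hV h]

lemma continuous_wienerPair (hV : HasBrownianCovariance V P) : Continuous (wienerPair hV) := by
  have hb : ∀ s t, ‖wienerPair hV s - wienerPair hV t‖ = √|s - t| := by
    intro s t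
    rcases le_total t s with h | h
    · rw [norm_wienerPair_sub hV h, abs_of_nonneg (by linarith)]
    · rw [norm_sub_rev, norm_wienerPair_sub hV h, abs_sub_comm, abs_of_nonneg (by linarith)]
  refine continuous_iff_continuousAt.2 fun t => ?_
  rw [ContinuousAt, tendsto_iff_norm_sub_tendsto_zero]
  simp only [hb]
  have : Continuous fun s : ℝ => √|s - t| := by fun_prop
  simpa using this.tendsto t

namespace StepIntegrand

/-- The sum of two step functions. -/
def add (φ ψ : StepIntegrand) : StepIntegrand where
  n := φ.n + ψ.n
  coef := Fin.append φ.coef ψ.coef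
  left := Fin.append φ.left ψ.left
  right := Fin.append φ.right ψ.right
  le i := by
    refine Fin.addCases (fun i => ?_) (fun i => ?_) i
    · simpa using φ.le i
    · simpa using ψ.le i

/-- A multiple of a step function. -/
def smul (c : ℝ) (φ : StepIntegrand) : StepIntegrand where
  n := φ.n
  coef i := c * φ.coef i
  left := φ.left
  right := φ.right
  le := φ.le

/-- The zero step function. -/
def zero : StepIntegrand where
  n := 0
  coef := Fin.elim0
  left := Fin.elim0
  right := Fin.elim0
  le i := i.elim0

/-- The indicator of a bounded half-open interval. -/
def single (a b : ℝ) (h : a ≤ b) : StepIntegrand where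
  n := 1
  coef _ := 1
  left _ := a
  right _ := b
  le _ := h

lemma memLp_toFun (φ : StepIntegrand) : MemLp φ.toFun 2 volume := by
  refine memLp_finsetSum (f := fun i s => φ.coef i *
    (Set.Ioc (φ.left i) (φ.right i)).indicator (fun _ => (1 : ℝ)) s) _ fun i _ => ?_
  exact (memLp_indicator_Ioc _ _).const_mul _

lemma memLp_integral (hV : HasBrownianCovariance V P) (φ : StepIntegrand) :
    MemLp (φ.integral V) 2 P := by
  refine memLp_finsetSum (f := fun i ω => φ.coef i *
    (V (φ.right i) ω - V (φ.left i) ω)) _ fun i _ => ?_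
  exact ((hV.memLp _).sub (hV.memLp _)).const_mul _

lemma toFun_add (φ ψ : StepIntegrand) (s : ℝ) :
    (φ.add ψ).toFun s = φ.toFun s + ψ.toFun s := by
  refine (Fin.sum_univ_add (fun i : Fin (φ.n + ψ.n) => Fin.append φ.coef ψ.coef i *
    (Set.Ioc (Fin.append φ.left ψ.left i) (Fin.append φ.right ψ.right i)).indicator
      (fun _ => (1 : ℝ)) s)).trans ?_
  simp only [Fin.append_left, Fin.append_right, toFun]

lemma integral_add {Ω : Type*} (φ ψ : StepIntegrand) (V : ℝ → Ω → ℝ) (ω : Ω) :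
    (φ.add ψ).integral V ω = φ.integral V ω + ψ.integral V ω := by
  refine (Fin.sum_univ_add (fun i : Fin (φ.n + ψ.n) => Fin.append φ.coef ψ.coef i *
    (V (Fin.append φ.right ψ.right i) ω - V (Fin.append φ.left ψ.left i) ω))).trans ?_
  simp only [Fin.append_left, Fin.append_right, integral]

lemma toFun_smul (c : ℝ) (φ : StepIntegrand) (s : ℝ) :
    (φ.smul c).toFun s = c * φ.toFun s := by
  simp only [toFun, smul, Finset.mul_sum, mul_assoc]
  rfl

lemma integral_smul {Ω : Type*} (c : ℝ) (φ : StepIntegrand) (V : ℝ → Ω → ℝ) (ω : Ω) :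
    (φ.smul c).integral V ω = c * φ.integral V ω := by
  simp only [integral, smul, Finset.mul_sum, mul_assoc]
  rfl

/-- The pair of a step function and its integral, as an element of `L²(ℝ) × L²(P)`. -/
noncomputable def toPair (hV : HasBrownianCovariance V P) (φ : StepIntegrand) :
    Lp ℝ 2 (volume : Measure ℝ) × Lp ℝ 2 P :=
  (φ.memLp_toFun.toLp _, (φ.memLp_integral hV).toLp _)

lemma toPair_add (hV : HasBrownianCovariance V P) (φ ψ : StepIntegrand) :
    (φ.add ψ).toPair hV = φ.toPair hV + ψ.toPair hV := by
  simp only [toPair, Prod.mk_add_mk, ← MemLp.toLp_add]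
  congr 2
  · funext s; exact toFun_add φ ψ s
  · funext s; exact integral_add φ ψ V s

lemma toPair_smul (hV : HasBrownianCovariance V P) (c : ℝ) (φ : StepIntegrand) :
    (φ.smul c).toPair hV = c • φ.toPair hV := by
  simp only [toPair, Prod.smul_mk, ← MemLp.toLp_const_smul]
  congr 2
  · funext s; exact toFun_smul c φ s
  · funext s; exact integral_smul c φ V s

lemma toPair_zero (hV : HasBrownianCovariance V P) : zero.toPair hV = 0 := by
  have : zero.smul 0 = zero := by
    simp only [smul, zero]
    congr
    funext i
    exact i.elim0
  have h := toPair_smul hV 0 zero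
  rwa [this, zero_smul] at h

lemma toPair_single (hV : HasBrownianCovariance V P) {a b : ℝ} (h : a ≤ b) :
    (single a b h).toPair hV = wienerPair hV b - wienerPair hV a := by
  refine Prod.ext ?_ ?_
  · rw [wienerPair_fst_sub hV h]
    simp only [toPair]
    congr 1
    funext s
    exact (Fin.sum_univ_one (fun _ => (1 : ℝ) * (Set.Ioc a b).indicator (fun _ => (1 : ℝ)) s)).trans
      (one_mul _)
  · simp only [toPair, wienerPair, Prod.snd_sub, ← MemLp.toLp_sub]
    congr 1
    funext s
    exact (Fin.sum_univ_one (fun _ => (1 : ℝ) * (V b s - V a s))).trans (one_mul _)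

end StepIntegrand

lemma mem_elementaryGraph_iff (hV : HasBrownianCovariance V P)
    (p : Lp ℝ 2 (volume : Measure ℝ) × Lp ℝ 2 P) :
    p ∈ elementaryGraph hV ↔ ∃ φ : StepIntegrand, φ.toPair hV = p := by
  constructor
  · intro hp
    induction hp using Submodule.span_induction with
    | mem x hx =>
      obtain ⟨a, b, h, rfl⟩ := hx
      exact ⟨_, StepIntegrand.toPair_single hV h⟩
    | zero => exact ⟨_, StepIntegrand.toPair_zero hV⟩
    | add x y _ _ h1 h2 =>
      obtain ⟨φ, rfl⟩ := h1
      obtain ⟨ψ, rfl⟩ := h2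
      exact ⟨_, StepIntegrand.toPair_add hV φ ψ⟩
    | smul c x _ h =>
      obtain ⟨φ, rfl⟩ := h
      exact ⟨_, StepIntegrand.toPair_smul hV c φ⟩
  · rintro ⟨φ, rfl⟩
    have : φ.toPair hV = ∑ i, φ.coef i •
        (wienerPair hV (φ.right i) - wienerPair hV (φ.left i)) := by
      refine Prod.ext ?_ ?_
      · rw [Prod.fst_sum]
        simp only [Prod.smul_fst, wienerPair_fst_sub hV (φ.le _), StepIntegrand.toPair]
        apply Lp.ext
        refine (MemLp.coeFn_toLp _).trans ?_
        refine EventuallyEq.trans ?_ (Lp.coeFn_finsetSum _ _).symm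
        have : ∀ᵐ x, ∀ i, ((φ.coef i • (memLp_indicator_Ioc (φ.left i) (φ.right i)).toLp _ :
            Lp ℝ 2 volume) : ℝ → ℝ) x = φ.coef i *
            (Set.Ioc (φ.left i) (φ.right i)).indicator (fun _ => (1 : ℝ)) x := by
          refine ae_all_iff.2 fun i => ?_
          filter_upwards [Lp.coeFn_smul (φ.coef i)
            ((memLp_indicator_Ioc (φ.left i) (φ.right i)).toLp _),
            (memLp_indicator_Ioc (φ.left i) (φ.right i)).coeFn_toLp] with x h1 h2
          rw [h1, Pi.smul_apply, h2, smul_eq_mul]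
        filter_upwards [this] with x hx
        simp [StepIntegrand.toFun, hx]
      · rw [Prod.snd_sum]
        simp only [Prod.smul_snd, Prod.snd_sub, wienerPair, StepIntegrand.toPair,
          ← MemLp.toLp_sub]
        apply Lp.ext
        refine (MemLp.coeFn_toLp _).trans ?_
        refine EventuallyEq.trans ?_ (Lp.coeFn_finsetSum _ _).symm
        have : ∀ᵐ x ∂P, ∀ i, ((φ.coef i • ((hV.memLp (φ.right i)).sub
            (hV.memLp (φ.left i))).toLp _ : Lp ℝ 2 P) : Ω → ℝ) x = φ.coef i *
            (V (φ.right i) x - V (φ.left i) x) := by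
          refine ae_all_iff.2 fun i => ?_
          filter_upwards [Lp.coeFn_smul (φ.coef i) (((hV.memLp (φ.right i)).sub
            (hV.memLp (φ.left i))).toLp _), ((hV.memLp (φ.right i)).sub
            (hV.memLp (φ.left i))).coeFn_toLp] with x h1 h2
          rw [h1, Pi.smul_apply, h2, smul_eq_mul, Pi.sub_apply]
        filter_upwards [this] with x hx
        simp [StepIntegrand.integral, hx]
    rw [this]
    exact Submodule.sum_mem _ fun i _ => Submodule.smul_mem _ _
      (Submodule.subset_span ⟨_, _, φ.le i, rfl⟩)

/-- `Y = ∫ f dV` if and only if `(f, Y)` lies in the closure of the graph of the elementary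
integral. -/
lemma isWienerIntegral_iff_mem_closure (hV : HasBrownianCovariance V P) {f : ℝ → ℝ} {Y : Ω → ℝ}
    (hf : MemLp f 2 volume) (hY : MemLp Y 2 P) :
    IsWienerIntegral V P f Y ↔
      (hf.toLp f, hY.toLp Y) ∈ (elementaryGraph hV).topologicalClosure := by
  have key : ∀ φ : ℕ → StepIntegrand,
      Tendsto (fun k => (φ k).toPair hV) atTop (𝓝 (hf.toLp f, hY.toLp Y)) ↔
      Tendsto (fun k => eLpNorm (fun s => (φ k).toFun s - f s) 2 volume) atTop (𝓝 0) ∧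
      Tendsto (fun k => eLpNorm (fun ω => (φ k).integral V ω - Y ω) 2 P) atTop (𝓝 0) := by
    intro φ
    rw [nhds_prod_eq, tendsto_prod_iff']
    simp only [StepIntegrand.toPair]
    rw [Lp.tendsto_Lp_iff_tendsto_eLpNorm'', Lp.tendsto_Lp_iff_tendsto_eLpNorm'']
    rfl
  rw [← SetLike.mem_coe, Submodule.topologicalClosure_coe, mem_closure_iff_seq_limit]
  constructor
  · rintro ⟨-, -, φ, h⟩
    exact ⟨fun k => (φ k).toPair hV, fun k => (mem_elementaryGraph_iff hV _).2 ⟨_, rfl⟩,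
      (key φ).2 h⟩
  · rintro ⟨x, hx, hlim⟩
    choose φ hφ using fun k => (mem_elementaryGraph_iff hV _).1 (hx k)
    refine ⟨hf, hY, φ, (key φ).1 ?_⟩
    simpa only [hφ] using hlim

/-- The Wiener integral is unique up to almost sure equality. -/
lemma IsWienerIntegral.ae_eq (hV : HasBrownianCovariance V P) {f : ℝ → ℝ} {Y Z : Ω → ℝ}
    (hY : IsWienerIntegral V P f Y) (hZ : IsWienerIntegral V P f Z) : Y =ᵐ[P] Z := by
  have h1 := (isWienerIntegral_iff_mem_closure hV hY.1 hY.2.1).1 hY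
  have h2 := (isWienerIntegral_iff_mem_closure hV hZ.1 hZ.2.1).1 hZ
  have h3 := norm_fst_eq_norm_snd hV (Submodule.sub_mem _ h1 h2)
  simp only [Prod.fst_sub, Prod.snd_sub, sub_self, norm_zero] at h3
  exact (MemLp.toLp_eq_toLp_iff _ _).1 (sub_eq_zero.1 (norm_eq_zero.1 h3.symm))

lemma IsWienerIntegral.add (hV : HasBrownianCovariance V P) {f g : ℝ → ℝ} {Y Z : Ω → ℝ}
    (hY : IsWienerIntegral V P f Y) (hZ : IsWienerIntegral V P g Z) :
    IsWienerIntegral V P (f + g) (Y + Z) := by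
  have h1 := (isWienerIntegral_iff_mem_closure hV hY.1 hY.2.1).1 hY
  have h2 := (isWienerIntegral_iff_mem_closure hV hZ.1 hZ.2.1).1 hZ
  exact (isWienerIntegral_iff_mem_closure hV (hY.1.add hZ.1) (hY.2.1.add hZ.2.1)).2
    (Submodule.add_mem _ h1 h2)

lemma IsWienerIntegral.const_smul (hV : HasBrownianCovariance V P) (c : ℝ) {f : ℝ → ℝ}
    {Y : Ω → ℝ} (hY : IsWienerIntegral V P f Y) : IsWienerIntegral V P (c • f) (c • Y) := by
  have h1 := (isWienerIntegral_iff_mem_closure hV hY.1 hY.2.1).1 hY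
  exact (isWienerIntegral_iff_mem_closure hV (hY.1.const_smul c) (hY.2.1.const_smul c)).2
    (Submodule.smul_mem _ c h1)

lemma IsWienerIntegral.congr (hV : HasBrownianCovariance V P) {f g : ℝ → ℝ} {Y Z : Ω → ℝ}
    (hY : IsWienerIntegral V P f Y) (hf : f =ᵐ[volume] g) (hYZ : Y =ᵐ[P] Z) :
    IsWienerIntegral V P g Z := by
  have h1 := (isWienerIntegral_iff_mem_closure hV hY.1 hY.2.1).1 hY
  refine (isWienerIntegral_iff_mem_closure hV (hY.1.ae_eq hf) (hY.2.1.ae_eq hYZ)).2 ?_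
  convert h1 using 2
  · exact (MemLp.toLp_eq_toLp_iff _ _).2 hf.symm
  · exact (MemLp.toLp_eq_toLp_iff _ _).2 hYZ.symm

lemma isWienerIntegral_Ioc (hV : HasBrownianCovariance V P) {a b : ℝ} (h : a ≤ b) :
    IsWienerIntegral V P ((Set.Ioc a b).indicator fun _ => (1 : ℝ)) (V b - V a) := by
  refine (isWienerIntegral_iff_mem_closure hV (memLp_indicator_Ioc a b)
    ((hV.memLp b).sub (hV.memLp a))).2 (Submodule.le_topologicalClosure _
      (Submodule.subset_span ⟨a, b, h, ?_⟩))
  refine Prod.ext (wienerPair_fst_sub hV h).symm ?_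
  exact (MemLp.toLp_sub (hV.memLp b) (hV.memLp a)).symm

end WienerIntegral

/-! ### The stochastic Fubini theorem -/

/-- A Bochner integrable family in `L²(μ)` with a jointly measurable representative is integrable
on sets of finite `μ`-measure. -/
lemma integrable_uncurry_of_integrable_Lp {X U : Type*} [MeasurableSpace X] [MeasurableSpace U]
    {μ : Measure X} {ν : Measure U} [SFinite μ] [SFinite ν] {a : U → Lp ℝ 2 μ}
    (ha : Integrable a ν) {g : U → X → ℝ} (hg : Measurable (Function.uncurry g))
    (hag : ∀ u, a u =ᵐ[μ] g u) {S : Set X} (hS : MeasurableSet S) (hμS : μ S ≠ ∞) :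
    Integrable (Function.uncurry g) (ν.prod (μ.restrict S)) := by
  have : IsFiniteMeasure (μ.restrict S) := ⟨by simpa using hμS.lt_top⟩
  rw [integrable_prod_iff hg.aestronglyMeasurable]
  constructor
  · refine Eventually.of_forall fun u => ?_
    have h1 : MemLp (a u) 2 (μ.restrict S) := (Lp.memLp (a u)).restrict S
    exact (h1.integrable (by norm_num)).congr (ae_restrict_of_ae (hag u))
  · refine Integrable.mono' (ha.norm.const_mul ‖indicatorConstLp 2 hS hμS (1 : ℝ)‖) ?_ ?_
    · exact (hg.norm.stronglyMeasurable.integral_prod_right).aestronglyMeasurable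
    · refine Eventually.of_forall fun u => ?_
      have h1 : ∫ x in S, ‖g u x‖ ∂μ = inner ℝ (indicatorConstLp 2 hS hμS (1 : ℝ)) |a u| := by
        rw [L2.inner_indicatorConstLp_one]
        refine integral_congr_ae (ae_restrict_of_ae ?_)
        filter_upwards [hag u, Lp.coeFn_abs (a u)] with x h1 h2
        rw [h2, h1, Real.norm_eq_abs]
      rw [Real.norm_of_nonneg (integral_nonneg fun x => norm_nonneg _)]
      refine h1.le.trans ((real_inner_le_norm _ _).trans ?_)
      rw [norm_abs_eq_norm]

/-- The Bochner integral of a family in `L²(μ)` is represented by the pointwise integrals. -/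
lemma coeFn_integral_Lp {X U : Type*} [MeasurableSpace X] [MeasurableSpace U]
    {μ : Measure X} {ν : Measure U} [SigmaFinite μ] [SFinite ν] {a : U → Lp ℝ 2 μ}
    (ha : Integrable a ν) {g : U → X → ℝ} (hg : Measurable (Function.uncurry g))
    (hag : ∀ u, a u =ᵐ[μ] g u) :
    ((∫ u, a u ∂ν : Lp ℝ 2 μ) : X → ℝ) =ᵐ[μ] fun x => ∫ u, g u x ∂ν := by
  refine ae_eq_of_forall_setIntegral_eq_of_sigmaFinite ?_ ?_ ?_
  · intro S hS hμS
    have : IsFiniteMeasure (μ.restrict S) := ⟨by simpa using hμS⟩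
    exact ((Lp.memLp _).restrict S).integrable (by norm_num)
  · intro S hS hμS
    exact (integrable_uncurry_of_integrable_Lp ha hg hag hS hμS.ne).integral_prod_right
  · intro S hS hμS
    have hi := integrable_uncurry_of_integrable_Lp ha hg hag hS hμS.ne
    rw [← L2.inner_indicatorConstLp_one hS hμS.ne (𝕜 := ℝ)]
    rw [← integral_inner ha, ← integral_integral_swap hi]
    refine integral_congr_ae (Eventually.of_forall fun u => ?_)
    simp only
    rw [L2.inner_indicatorConstLp_one hS hμS.ne (𝕜 := ℝ)]
    exact integral_congr_ae (ae_restrict_of_ae (hag u))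

lemma Submodule.integral_mem_of_isClosed {E U : Type*} [NormedAddCommGroup E] [NormedSpace ℝ E]
    [CompleteSpace E] [MeasurableSpace U] {ν : Measure U} (G : Submodule ℝ E)
    (hG : IsClosed (G : Set E)) {a : U → E} (ha : ∀ u, a u ∈ G) (hi : Integrable a ν) :
    ∫ u, a u ∂ν ∈ G := by
  have : IsClosed (G : Set E) := hG
  rw [← Submodule.Quotient.mk_eq_zero]
  have h := G.mkQL.integral_comp_comm hi
  have h0 : ∀ u, G.mkQL (a u) = 0 := fun u => (Submodule.Quotient.mk_eq_zero G).2 (ha u)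
  simp only [h0, integral_zero] at h
  exact h.symm

section StochasticFubini

variable {Ω U : Type*} [MeasurableSpace Ω] [MeasurableSpace U] {P : Measure Ω}
  {V : ℝ → Ω → ℝ} {ν : Measure U} {c l r : U → ℝ}

lemma integrable_wienerPair (hV : HasBrownianCovariance V P) (hc : Measurable c)
    (hl : Measurable l) (hr : Measurable r) (hlr : ∀ u, l u ≤ r u)
    (hi : Integrable (fun u => c u * √(r u - l u)) ν) :
    Integrable (fun u => c u • (wienerPair hV (r u) - wienerPair hV (l u))) ν := by
  have hm : StronglyMeasurable (wienerPair hV) := (continuous_wienerPair hV).stronglyMeasurable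
  refine hi.mono (hc.stronglyMeasurable.smul ((hm.comp_measurable hr).sub
    (hm.comp_measurable hl))).aestronglyMeasurable (Eventually.of_forall fun u => ?_)
  rw [norm_smul, norm_wienerPair_sub hV (hlr u), norm_mul, Real.norm_of_nonneg (Real.sqrt_nonneg _)]

variable [IsProbabilityMeasure P] [SFinite ν]

/-- Stochastic Fubini theorem for the Wiener integral: a superposition of indicators of intervals
integrates to the superposition of the increments. -/
lemma isWienerIntegral_integral (hV : HasBrownianCovariance V P)
    (hVm : Measurable (Function.uncurry V)) (hc : Measurable c)
    (hl : Measurable l) (hr : Measurable r) (hlr : ∀ u, l u ≤ r u)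
    (hi : Integrable (fun u => c u * √(r u - l u)) ν) :
    IsWienerIntegral V P
      (fun s => ∫ u, c u * (Set.Ioc (l u) (r u)).indicator (fun _ => (1 : ℝ)) s ∂ν)
      (fun ω => ∫ u, c u * (V (r u) ω - V (l u) ω) ∂ν) := by
  have hI := integrable_wienerPair hV hc hl hr hlr hi
  set p := ∫ u, c u • (wienerPair hV (r u) - wienerPair hV (l u)) ∂ν with hp
  have hmem : p ∈ (elementaryGraph hV).topologicalClosure := by
    refine Submodule.integral_mem_of_isClosed _ (Submodule.isClosed_topologicalClosure _)
      (fun u => ?_) hI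
    exact Submodule.smul_mem _ _ (Submodule.le_topologicalClosure _
      (Submodule.subset_span ⟨_, _, hlr u, rfl⟩))
  have h1 : (p.1 : ℝ → ℝ) =ᵐ[volume]
      fun s => ∫ u, c u * (Set.Ioc (l u) (r u)).indicator (fun _ => (1 : ℝ)) s ∂ν := by
    rw [hp, fst_integral hI]
    refine coeFn_integral_Lp hI.fst ?_ fun u => ?_
    · have hset : MeasurableSet {q : U × ℝ | q.2 ∈ Set.Ioc (l q.1) (r q.1)} :=
        (measurableSet_lt (hl.comp measurable_fst) measurable_snd).inter
          (measurableSet_le measurable_snd (hr.comp measurable_fst))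
      exact (hc.comp measurable_fst).mul (measurable_const.indicator hset)
    · rw [Prod.smul_fst, wienerPair_fst_sub hV (hlr u)]
      filter_upwards [Lp.coeFn_smul (c u) ((memLp_indicator_Ioc (l u) (r u)).toLp _),
        (memLp_indicator_Ioc (l u) (r u)).coeFn_toLp] with s h1 h2
      rw [h1, Pi.smul_apply, h2, smul_eq_mul]
  have h2 : (p.2 : Ω → ℝ) =ᵐ[P] fun ω => ∫ u, c u * (V (r u) ω - V (l u) ω) ∂ν := by
    rw [hp, snd_integral hI]
    refine coeFn_integral_Lp hI.snd ?_ fun u => ?_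
    · exact (hc.comp measurable_fst).mul
        ((hVm.comp ((hr.comp measurable_fst).prodMk measurable_snd)).sub
          (hVm.comp ((hl.comp measurable_fst).prodMk measurable_snd)))
    · simp only [Prod.smul_snd, Prod.snd_sub, wienerPair, ← MemLp.toLp_sub,
        ← MemLp.toLp_const_smul]
      exact MemLp.coeFn_toLp _
  refine IsWienerIntegral.congr hV ?_ h1 h2
  rw [isWienerIntegral_iff_mem_closure hV (Lp.memLp p.1) (Lp.memLp p.2), Lp.toLp_coeFn,
    Lp.toLp_coeFn]
  exact hmem

lemma ae_integrable_increments (hV : HasBrownianCovariance V P)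
    (hVm : Measurable (Function.uncurry V)) (hc : Measurable c)
    (hl : Measurable l) (hr : Measurable r) (hlr : ∀ u, l u ≤ r u)
    (hi : Integrable (fun u => c u * √(r u - l u)) ν) :
    ∀ᵐ ω ∂P, Integrable (fun u => c u * (V (r u) ω - V (l u) ω)) ν := by
  have hI := (integrable_wienerPair hV hc hl hr hlr hi).snd
  have h := integrable_uncurry_of_integrable_Lp hI
    (g := fun u ω => c u * (V (r u) ω - V (l u) ω)) ?_ (fun u => ?_) MeasurableSet.univ (by simp)
  · rw [Measure.restrict_univ] at h
    exact h.swap.prod_right_ae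
  · exact (hc.comp measurable_fst).mul
      ((hVm.comp ((hr.comp measurable_fst).prodMk measurable_snd)).sub
        (hVm.comp ((hl.comp measurable_fst).prodMk measurable_snd)))
  · simp only [Prod.smul_snd, Prod.snd_sub, wienerPair, ← MemLp.toLp_sub,
      ← MemLp.toLp_const_smul]
    exact MemLp.coeFn_toLp _

end StochasticFubini

/-! ### The Mandelbrot–van Ness kernel as a superposition of indicators -/

/-- The increments `w_t - w_{t-u}`, `0 < u < 1`, weighted by `u⁻¹`. They carry the part of the
moving average that stems from the singularity of the kernel at `t`. The absolute value only serves
to keep `t - |u| ≤ t` for every real `u`. -/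
noncomputable def nearIncrement (w : ℝ → ℝ) (t u : ℝ) : ℝ := u⁻¹ * (w t - w (t - |u|))

/-- The increments `w_{v-1} - w_{v-u}`, `0 < v ≤ t`, `1 < u`, weighted by `u⁻²`. They carry the
part of the moving average that stems from the tail of the kernel. The maximum only serves to keep
`v - max u 1 ≤ v - 1` for every real `u`. -/
noncomputable def farIncrement (w : ℝ → ℝ) (t : ℝ) (p : ℝ × ℝ) : ℝ :=
  (Set.Iic t).indicator (fun _ => (1 : ℝ)) p.2 *
    ((p.1 ^ 2)⁻¹ * (w (p.2 - 1) - w (p.2 - max p.1 1)))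

/-- The measure carrying the variable `u` of `nearIncrement`. -/
noncomputable def nearMeasure : Measure ℝ := volume.restrict (Set.Ioo 0 1)

/-- The measure carrying the variable `(u, v)` of `farIncrement`. -/
noncomputable def farMeasure : Measure (ℝ × ℝ) :=
  (volume.restrict (Set.Ioi 1)).prod (volume.restrict (Set.Ioi 0))

/-- The pathwise form of the Wiener integral `∫ K_H(s, t) dw_s` for `H = α + 1/2`, obtained from
`∫ dw` by writing the kernel as a superposition of indicators of intervals. -/
noncomputable def mvnPath (w : ℝ → ℝ) (α t : ℝ) : ℝ :=
  (w t - w 0)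
    + α * ((∫ u, u ^ α * nearIncrement w 0 u ∂nearMeasure)
      - ∫ u, u ^ α * nearIncrement w t u ∂nearMeasure)
    + α * (1 - α) * ∫ p, p.1 ^ α * farIncrement w t p ∂farMeasure

instance : SFinite nearMeasure := by unfold nearMeasure; infer_instance

instance : SFinite farMeasure := by unfold farMeasure; infer_instance

lemma mul_integral_rpow_sub_one (α : ℝ) {x y : ℝ} (hx : 0 < x) (hxy : x ≤ y) :
    α * ∫ u in x..y, u ^ (α - 1) = y ^ α - x ^ α := by
  rcases eq_or_ne α 0 with rfl | hα
  · simp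
  · rw [integral_rpow (Or.inr ⟨by intro h; apply hα; linarith, ?_⟩)]
    · rw [sub_add_cancel]
      field_simp
    · rw [Set.uIcc_of_le hxy]
      intro h
      exact absurd h.1 (not_le.2 hx)

/-- The superposition of indicators behind `nearIncrement` equals `1 - (t - s) ^ α` at distance less
than `1` to the left of `t`, and vanishes elsewhere. -/
lemma integral_near_indicator (α t : ℝ) {s : ℝ} (hs : s ≠ t) :
    α * ∫ u, u ^ α * u⁻¹ * (Set.Ioc (t - |u|) t).indicator (fun _ => (1 : ℝ)) s ∂nearMeasure
      = if 0 < t - s ∧ t - s < 1 then 1 - (t - s) ^ α else 0 := by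
  rw [nearMeasure]
  split_ifs with h
  · have h1 : ∫ u in Set.Ioo 0 1, u ^ α * u⁻¹ *
        (Set.Ioc (t - |u|) t).indicator (fun _ => (1 : ℝ)) s
        = ∫ u in Set.Ioo 0 1, (Set.Ioo (t - s) 1).indicator (fun u => u ^ (α - 1)) u := by
      refine setIntegral_congr_fun measurableSet_Ioo fun u hu => ?_
      simp only [Set.indicator_apply, Set.mem_Ioc, Set.mem_Ioo, abs_of_pos hu.1]
      rw [Real.rpow_sub_one hu.1.ne', div_eq_mul_inv]
      have := hu.2
      grind
    rw [h1, setIntegral_indicator measurableSet_Ioo, Set.Ioo_inter_Ioo, max_eq_right h.1.le,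
      min_self, ← integral_Ioc_eq_integral_Ioo, ← intervalIntegral.integral_of_le h.2.le,
      mul_integral_rpow_sub_one α h.1 h.2.le, Real.one_rpow]
  · rw [setIntegral_eq_zero_of_forall_eq_zero, mul_zero]
    intro u hu
    rw [Set.indicator_of_notMem, mul_zero]
    rintro ⟨h1, h2⟩
    rw [abs_of_pos hu.1] at h1
    have h3 : s < t := lt_of_le_of_ne h2 hs
    exact h ⟨by linarith, by linarith [hu.2]⟩

lemma integrableOn_rpow_Ioi_one {α : ℝ} (hα : α < 1) :
    Integrable (fun u : ℝ => u ^ (α - 2)) (volume.restrict (Set.Ioi 1)) :=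
  integrableOn_Ioi_rpow_of_lt (by linarith) one_pos

lemma rpow_mul_inv_sq {α u : ℝ} (hu : 0 < u) : u ^ α * (u ^ 2)⁻¹ = u ^ (α - 2) := by
  rw [Real.rpow_sub hu, div_eq_mul_inv]
  norm_num

lemma ae_farMeasure : ∀ᵐ p ∂farMeasure, 1 < p.1 ∧ 0 < p.2 := by
  rw [farMeasure, Measure.prod_restrict]
  exact (ae_restrict_mem (measurableSet_Ioi.prod measurableSet_Ioi))

/-- `c(u) 1_{v ≤ t}` is integrable on the domain of the tail as soon as `c` is. -/
lemma integrable_mul_indicator_Iic {c : ℝ → ℝ} (hc : Integrable c (volume.restrict (Set.Ioi 1)))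
    (t : ℝ) :
    Integrable (fun p : ℝ × ℝ => c p.1 * (Set.Iic t).indicator (fun _ => (1 : ℝ)) p.2)
      farMeasure := by
  refine hc.mul_prod (g := (Set.Iic t).indicator (fun _ => (1 : ℝ))) ?_
  rw [integrable_indicator_iff measurableSet_Iic, IntegrableOn,
    Measure.restrict_restrict measurableSet_Iic, Set.inter_comm, Set.Ioi_inter_Iic]
  exact integrableOn_const (by simp)

/-- The superposition of indicators behind `farIncrement` is an increment of the function
`x ↦ max 1 x ^ α`: the integral over `u` gives its derivative, up to the factor `1 - α`, and the
integral over `v` the increment. -/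
lemma integral_far_indicator {α t : ℝ} (hα : α < 1) (ht : 0 ≤ t) (s : ℝ) :
    α * (1 - α) * ∫ p, p.1 ^ α * ((Set.Iic t).indicator (fun _ => (1 : ℝ)) p.2 * (p.1 ^ 2)⁻¹) *
        (Set.Ioc (p.2 - max p.1 1) (p.2 - 1)).indicator (fun _ => (1 : ℝ)) s ∂farMeasure
      = max 1 (t - s) ^ α - max 1 (-s) ^ α := by
  have hint : Integrable (fun p : ℝ × ℝ => p.1 ^ α *
      ((Set.Iic t).indicator (fun _ => (1 : ℝ)) p.2 * (p.1 ^ 2)⁻¹) *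
        (Set.Ioc (p.2 - max p.1 1) (p.2 - 1)).indicator (fun _ => (1 : ℝ)) s) farMeasure := by
    refine (integrable_mul_indicator_Iic (integrableOn_rpow_Ioi_one hα) t).mono' ?_ ?_
    · refine Measurable.aestronglyMeasurable ?_
      refine Measurable.mul ?_ ?_
      · have : Measurable fun p : ℝ × ℝ => (Set.Iic t).indicator (fun _ => (1 : ℝ)) p.2 :=
          (measurable_const.indicator measurableSet_Iic).comp measurable_snd
        fun_prop
      · have hset : MeasurableSet {p : ℝ × ℝ | s ∈ Set.Ioc (p.2 - max p.1 1) (p.2 - 1)} :=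
          (measurableSet_lt (f := fun p : ℝ × ℝ => p.2 - max p.1 1) (by fun_prop)
            measurable_const).inter (measurableSet_le (g := fun p : ℝ × ℝ => p.2 - 1)
              measurable_const (by fun_prop))
        exact measurable_const.indicator hset
    · filter_upwards [ae_farMeasure] with p hp
      have h0 : 0 < p.1 := by linarith [hp.1]
      rw [← rpow_mul_inv_sq h0]
      have h1 : 0 ≤ p.1 ^ α * (p.1 ^ 2)⁻¹ := by positivity
      simp only [Set.indicator_apply]
      split_ifs <;> simp [abs_of_pos h0, abs_of_nonneg (Real.rpow_nonneg h0.le α), h1]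
  rw [farMeasure] at hint ⊢
  rw [integral_prod_symm _ hint]
  -- the inner integral over `u`
  have hinner : ∀ v, (∫ u in Set.Ioi 1, u ^ α *
      ((Set.Iic t).indicator (fun _ => (1 : ℝ)) v * (u ^ 2)⁻¹) *
        (Set.Ioc (v - max u 1) (v - 1)).indicator (fun _ => (1 : ℝ)) s) =
      (1 - α)⁻¹ * (Set.Icc (s + 1) t).indicator (fun v => (v - s) ^ (α - 1)) v := by
    intro v
    by_cases hv : v ∈ Set.Icc (s + 1) t
    · rw [Set.indicator_of_mem hv]
      have h1 : ∫ u in Set.Ioi 1, u ^ α *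
          ((Set.Iic t).indicator (fun _ => (1 : ℝ)) v * (u ^ 2)⁻¹) *
            (Set.Ioc (v - max u 1) (v - 1)).indicator (fun _ => (1 : ℝ)) s
          = ∫ u in Set.Ioi 1, (Set.Ioi (v - s)).indicator (fun u => u ^ (α - 2)) u := by
        refine setIntegral_congr_fun measurableSet_Ioi fun u hu => ?_
        have hu' : 1 < u := hu
        have hu0 : 0 < u := by linarith
        simp only [Set.indicator_apply, Set.mem_Ioc, Set.mem_Iic, Set.mem_Ioi, hv.2, if_true,
          max_eq_left hu'.le, one_mul, rpow_mul_inv_sq hu0]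
        have := hv.1
        grind
      have hvs : 1 ≤ v - s := by linarith [hv.1]
      rw [h1, setIntegral_indicator measurableSet_Ioi, Set.Ioi_inter_Ioi, max_eq_right hvs,
        integral_Ioi_rpow_of_lt (by linarith) (by linarith)]
      have : 1 - α ≠ 0 := by linarith
      rw [show α - 2 + 1 = -(1 - α) by ring, show α - 1 = -(1 - α) by ring]
      field_simp
    · rw [Set.indicator_of_notMem hv, mul_zero]
      refine setIntegral_eq_zero_of_forall_eq_zero fun u hu => ?_
      simp only [Set.indicator_apply, Set.mem_Ioc, Set.mem_Iic]
      simp only [Set.mem_Icc, not_and_or, not_le] at hv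
      rcases hv with hv | hv
      · rw [if_neg (c := _ ∧ _), mul_zero]
        intro h
        linarith [h.2]
      · rw [if_neg (not_le.2 hv)]
        simp
  simp only [hinner]
  have h1α : 1 - α ≠ 0 := by linarith
  rw [integral_const_mul, ← mul_assoc, mul_inv_cancel_right₀ h1α,
    setIntegral_indicator measurableSet_Icc]
  by_cases hst : s + 1 ≤ t
  · have hset : (Set.Ioi 0 ∩ Set.Icc (s + 1) t : Set ℝ) =ᵐ[volume] Set.Ioc (max 0 (s + 1)) t := by
      have : Set.Ioc (max 0 (s + 1)) t = Set.Ioi 0 ∩ Set.Ioc (s + 1) t := by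
        ext v
        simp only [Set.mem_Ioc, Set.mem_inter_iff, Set.mem_Ioi, max_lt_iff]
        tauto
      rw [this]
      exact ae_eq_set_inter (ae_eq_refl _) Ioc_ae_eq_Icc.symm
    have hle : max 0 (s + 1) ≤ t := max_le ht hst
    rw [setIntegral_congr_set hset, ← intervalIntegral.integral_of_le hle,
      intervalIntegral.integral_comp_sub_right (fun x => x ^ (α - 1)),
      mul_integral_rpow_sub_one α (by grind) (by linarith)]
    congr 2 <;> grind
  · have hset : (Set.Ioi 0 ∩ Set.Icc (s + 1) t : Set ℝ) = ∅ := by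
      rw [Set.Icc_eq_empty hst, Set.inter_empty]
    rw [hset]
    have h1 : max 1 (t - s) = 1 := max_eq_left (by linarith)
    have h2 : max 1 (-s) = 1 := max_eq_left (by linarith)
    simp [h1, h2]

/-- The kernel in terms of the values of the three superpositions of indicators, which are computed
in `integral_near_indicator` and `integral_far_indicator`. -/
lemma mvnKernel_eq {H s t : ℝ} (ht : 0 ≤ t) (hs : s ≠ t) (hs0 : s ≠ 0) :
    mvnKernel H s t = (Set.Ioc 0 t).indicator (fun _ => (1 : ℝ)) s
      + ((if 0 < 0 - s ∧ 0 - s < 1 then 1 - (0 - s) ^ (H - 1 / 2) else 0)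
        - (if 0 < t - s ∧ t - s < 1 then 1 - (t - s) ^ (H - 1 / 2) else 0))
      + (max 1 (t - s) ^ (H - 1 / 2) - max 1 (-s) ^ (H - 1 / 2)) := by
  set α := H - 1 / 2
  have h1 : (1 : ℝ) ^ α = 1 := Real.one_rpow α
  simp only [mvnKernel, Set.indicator_apply, Set.mem_Iio, Set.mem_Ico, Set.mem_Ioc, zero_sub]
  rcases lt_or_gt_of_ne hs0 with h0 | h0
  · have e1 : |t - s| = t - s := abs_of_pos (by linarith)
    have e2 : |s| = -s := abs_of_neg h0
    rw [e1, e2]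
    rcases le_or_gt 1 (t - s) with h2 | h2 <;> rcases le_or_gt 1 (-s) with h3 | h3
    · rw [max_eq_right h2, max_eq_right h3]; grind
    · rw [max_eq_right h2, max_eq_left h3.le]; grind
    · linarith
    · rw [max_eq_left h2.le, max_eq_left h3.le]; grind
  · rw [max_eq_left (by linarith : -s ≤ 1)]
    rcases lt_or_gt_of_ne hs with h4 | h4
    · have e1 : |t - s| = t - s := abs_of_pos (by linarith)
      rw [e1]
      rcases le_or_gt 1 (t - s) with h2 | h2
      · rw [max_eq_right h2]; grind
      · rw [max_eq_left h2.le]; grind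
    · rw [max_eq_left (by linarith : t - s ≤ 1)]; grind

section

variable {Ω : Type*} [MeasurableSpace Ω] {P : Measure Ω} [IsProbabilityMeasure P]
  {V : ℝ → Ω → ℝ}

/-- The `L²` norms `√u` of the indicators make the singularity at `u = 0` integrable precisely for
`α > -1 / 2`. -/
lemma integrable_near_sqrt {α : ℝ} (hα : -(1 / 2) < α) (t : ℝ) :
    Integrable (fun u => u ^ α * u⁻¹ * √(t - (t - |u|))) nearMeasure := by
  have h : IntegrableOn (fun u : ℝ => u ^ (α - 1 / 2)) (Set.Ioo 0 1) := by
    have := (intervalIntegral.intervalIntegrable_rpow' (a := 0) (b := 1) (r := α - 1 / 2)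
      (by linarith)).1
    exact this.mono_set Set.Ioo_subset_Ioc_self
  refine h.congr ?_
  filter_upwards [ae_restrict_mem measurableSet_Ioo] with u hu
  rw [sub_sub_cancel, abs_of_pos hu.1, Real.sqrt_eq_rpow, ← Real.rpow_neg_one,
    ← Real.rpow_add hu.1, ← Real.rpow_add hu.1]
  congr 1
  ring

/-- The `L²` norms `√(u - 1)` of the indicators leave the tail at `u = ∞` integrable for
`α < 1 / 2`. -/
lemma integrable_far_sqrt {α : ℝ} (hα : α < 1 / 2) (t : ℝ) :
    Integrable (fun p : ℝ × ℝ => p.1 ^ α * ((Set.Iic t).indicator (fun _ => (1 : ℝ)) p.2 *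
      (p.1 ^ 2)⁻¹) * √((p.2 - 1) - (p.2 - max p.1 1))) farMeasure := by
  refine (integrable_mul_indicator_Iic
    (integrableOn_rpow_Ioi_one (α := α + 1 / 2) (by linarith)) t).mono' ?_ ?_
  · refine Measurable.aestronglyMeasurable ?_
    have : Measurable fun p : ℝ × ℝ => (Set.Iic t).indicator (fun _ => (1 : ℝ)) p.2 :=
      (measurable_const.indicator measurableSet_Iic).comp measurable_snd
    fun_prop
  · filter_upwards [ae_farMeasure] with p hp
    have h0 : 0 < p.1 := by linarith [hp.1]
    have h1 : √((p.2 - 1) - (p.2 - max p.1 1)) ≤ p.1 ^ (1 / 2 : ℝ) := by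
      rw [max_eq_left hp.1.le, Real.sqrt_eq_rpow]
      exact Real.rpow_le_rpow (by linarith [hp.1]) (by linarith) (by norm_num)
    have h2 : p.1 ^ (α + 1 / 2 - 2) = p.1 ^ α * (p.1 ^ 2)⁻¹ * p.1 ^ (1 / 2 : ℝ) := by
      rw [rpow_mul_inv_sq h0, ← Real.rpow_add h0]
      congr 1
      ring
    rw [h2]
    have h3 : 0 ≤ (Set.Iic t).indicator (fun _ => (1 : ℝ)) p.2 :=
      Set.indicator_nonneg (fun _ _ => zero_le_one) _
    rw [Real.norm_of_nonneg (by positivity)]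
    calc p.1 ^ α * ((Set.Iic t).indicator (fun _ => (1 : ℝ)) p.2 * (p.1 ^ 2)⁻¹) *
          √((p.2 - 1) - (p.2 - max p.1 1))
        ≤ p.1 ^ α * ((Set.Iic t).indicator (fun _ => (1 : ℝ)) p.2 * (p.1 ^ 2)⁻¹) *
          p.1 ^ (1 / 2 : ℝ) := by gcongr
      _ = _ := by ring

lemma measurable_far_coef (α t : ℝ) :
    Measurable (fun p : ℝ × ℝ => p.1 ^ α * ((Set.Iic t).indicator (fun _ => (1 : ℝ)) p.2 *
      (p.1 ^ 2)⁻¹)) := by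
  have : Measurable fun p : ℝ × ℝ => (Set.Iic t).indicator (fun _ => (1 : ℝ)) p.2 :=
    (measurable_const.indicator measurableSet_Iic).comp measurable_snd
  fun_prop

lemma isWienerIntegral_near (hV : HasBrownianCovariance V P)
    (hVm : Measurable (Function.uncurry V)) {α : ℝ} (hα : -(1 / 2) < α) (t : ℝ) :
    IsWienerIntegral V P
      (α • fun s => ∫ u, u ^ α * u⁻¹ * (Set.Ioc (t - |u|) t).indicator (fun _ => (1 : ℝ)) s
        ∂nearMeasure)
      (α • fun ω => ∫ u, u ^ α * nearIncrement (fun s => V s ω) t u ∂nearMeasure) := by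
  have h := isWienerIntegral_integral hV hVm (ν := nearMeasure) (c := fun u => u ^ α * u⁻¹)
    (l := fun u => t - |u|) (r := fun _ => t) (by fun_prop) (by fun_prop) (by fun_prop)
    (fun u => by simp) (integrable_near_sqrt hα t)
  simp only [mul_assoc] at h ⊢
  exact h.const_smul hV α

lemma isWienerIntegral_far (hV : HasBrownianCovariance V P)
    (hVm : Measurable (Function.uncurry V)) {α : ℝ} (hα : α < 1 / 2) (t : ℝ) :
    IsWienerIntegral V P
      ((α * (1 - α)) • fun s => ∫ p, p.1 ^ α *
        ((Set.Iic t).indicator (fun _ => (1 : ℝ)) p.2 * (p.1 ^ 2)⁻¹) *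
        (Set.Ioc (p.2 - max p.1 1) (p.2 - 1)).indicator (fun _ => (1 : ℝ)) s ∂farMeasure)
      ((α * (1 - α)) • fun ω => ∫ p, p.1 ^ α * farIncrement (fun s => V s ω) t p
        ∂farMeasure) := by
  have h := isWienerIntegral_integral hV hVm (ν := farMeasure)
    (l := fun p => p.2 - max p.1 1) (r := fun p => p.2 - 1) (measurable_far_coef α t)
    (by fun_prop) (by fun_prop) (fun p => sub_le_sub_left (le_max_right _ _) _)
    (integrable_far_sqrt hα t)
  simp only [farIncrement, mul_assoc] at h ⊢
  exact h.const_smul hV _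

/-- The Wiener integral of the Mandelbrot–van Ness kernel in pathwise form. -/
lemma isWienerIntegral_mvnPath (hV : HasBrownianCovariance V P)
    (hVm : Measurable (Function.uncurry V)) {H t : ℝ} (hH : H ∈ Set.Ioo (0 : ℝ) 1) (ht : 0 ≤ t) :
    IsWienerIntegral V P (fun s => mvnKernel H s t)
      (fun ω => mvnPath (fun s => V s ω) (H - 1 / 2) t) := by
  have hα1 : -(1 / 2) < H - 1 / 2 := by linarith [hH.1]
  have hα2 : H - 1 / 2 < 1 / 2 := by linarith [hH.2]
  have h0 := isWienerIntegral_Ioc hV ht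
  have h1 := isWienerIntegral_near hV hVm hα1 0
  have h2 := (isWienerIntegral_near hV hVm hα1 t).const_smul hV (-1)
  have h3 := isWienerIntegral_far hV hVm hα2 t
  refine ((h0.add hV (h1.add hV h2)).add hV h3).congr hV ?_ ?_
  · have hnull : ∀ᵐ s : ℝ, s ≠ t ∧ s ≠ 0 := by
      have ha : ∀ x : ℝ, ∀ᵐ s : ℝ, s ≠ x := fun x => by simp [ae_iff]
      filter_upwards [ha t, ha 0] with s h1 h2 using ⟨h1, h2⟩
    filter_upwards [hnull] with s hs
    simp only [Pi.add_apply, Pi.smul_apply, smul_eq_mul]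
    rw [integral_near_indicator _ 0 hs.2, integral_near_indicator _ t hs.1,
      integral_far_indicator (by linarith) ht, mvnKernel_eq ht hs.1 hs.2]
    ring
  · refine Eventually.of_forall fun ω => ?_
    simp only [Pi.add_apply, Pi.smul_apply, smul_eq_mul, Pi.sub_apply, mvnPath]
    ring

end

/-! ### Differentiability in the Hurst parameter along regular paths -/

lemma rpow_le_rpow_add_rpow {z a b γ : ℝ} (hz : 0 < z) (ha : a ≤ γ) (hb : γ ≤ b) :
    z ^ γ ≤ z ^ a + z ^ b := by
  have h1 := Real.rpow_pos_of_pos hz a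
  have h2 := Real.rpow_pos_of_pos hz b
  rcases le_total z 1 with h | h
  · linarith [Real.rpow_le_rpow_of_exponent_ge hz h ha]
  · linarith [Real.rpow_le_rpow_of_exponent_le h hb]

lemma abs_log_le_rpow_add_rpow {z ε : ℝ} (hz : 0 < z) (hε : 0 < ε) :
    |Real.log z| ≤ (z ^ ε + z ^ (-ε)) / ε := by
  have h1 := Real.log_le_rpow_div hz.le hε
  have h2 := Real.log_le_rpow_div (inv_nonneg.2 hz.le) hε
  rw [Real.log_inv, Real.inv_rpow hz.le, ← Real.rpow_neg hz.le] at h2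
  have h3 := div_nonneg (Real.rpow_nonneg hz.le ε) hε.le
  have h4 := div_nonneg (Real.rpow_nonneg hz.le (-ε)) hε.le
  rw [add_div, abs_le]
  constructor <;> linarith

/-- Both `z ^ α` and its derivative in `α` are controlled near `α₀` by powers of `z` with exponents
near `α₀`. -/
lemma rpow_mul_log_bound {z α₀ α ε : ℝ} (hz : 0 < z) (hε : 0 < ε)
    (hα : α ∈ Set.Ioo (α₀ - ε) (α₀ + ε)) :
    |z ^ α * Real.log z| ≤ 2 / ε * (z ^ (α₀ - 2 * ε) + z ^ (α₀ + 2 * ε)) := by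
  rw [abs_mul, abs_of_pos (Real.rpow_pos_of_pos hz α)]
  have h1 := rpow_le_rpow_add_rpow hz (a := α₀ - 2 * ε) (b := α₀ + 2 * ε) (γ := α + ε)
    (by linarith [hα.1]) (by linarith [hα.2])
  have h2 := rpow_le_rpow_add_rpow hz (a := α₀ - 2 * ε) (b := α₀ + 2 * ε) (γ := α + -ε)
    (by linarith [hα.1]) (by linarith [hα.2])
  calc z ^ α * |Real.log z| ≤ z ^ α * ((z ^ ε + z ^ (-ε)) / ε) := by
        gcongr
        exact abs_log_le_rpow_add_rpow hz hε
    _ = (z ^ (α + ε) + z ^ (α + -ε)) / ε := by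
        rw [Real.rpow_add hz, Real.rpow_add hz]; ring
    _ ≤ _ := by
        rw [div_mul_eq_mul_div]
        gcongr
        linarith

section ParametricPowers

variable {X : Type*} [MeasurableSpace X] {ν : Measure X} {z : X → ℝ} {A : ℝ → X → ℝ} {lo hi : ℝ}

/-- Integrable bounds for each single exponent give one for all exponents near `α₀`, which also
dominates the derivative in the exponent. -/
lemma exists_integrable_bound (hz : ∀ᵐ x ∂ν, 0 < z x)
    (hdom : ∀ a ∈ Set.Ioo lo hi, ∀ T : ℝ, ∃ g : X → ℝ, Integrable g ν ∧
      ∀ t ∈ Set.Icc 0 T, ∀ᵐ x ∂ν, z x ^ a * |A t x| ≤ g x)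
    {α₀ : ℝ} (hα₀ : α₀ ∈ Set.Ioo lo hi) (T : ℝ) :
    ∃ ε > 0, Set.Ioo (α₀ - ε) (α₀ + ε) ⊆ Set.Ioo lo hi ∧ ∃ g : X → ℝ, Integrable g ν ∧
      ∀ t ∈ Set.Icc 0 T, ∀ᵐ x ∂ν, ∀ α ∈ Set.Ioo (α₀ - ε) (α₀ + ε),
        ‖z x ^ α * A t x‖ ≤ g x ∧ ‖z x ^ α * Real.log (z x) * A t x‖ ≤ g x := by
  obtain ⟨ε, hε, h1, h2⟩ : ∃ ε > 0, lo < α₀ - 2 * ε ∧ α₀ + 2 * ε < hi := by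
    refine ⟨min (α₀ - lo) (hi - α₀) / 4, ?_, ?_, ?_⟩
    · have := lt_min (sub_pos.2 hα₀.1) (sub_pos.2 hα₀.2)
      positivity
    · have := min_le_left (α₀ - lo) (hi - α₀)
      linarith [hα₀.1]
    · have := min_le_right (α₀ - lo) (hi - α₀)
      linarith [hα₀.2]
  obtain ⟨g₁, hg₁, hb₁⟩ := hdom (α₀ - 2 * ε) ⟨h1, by linarith⟩ T
  obtain ⟨g₂, hg₂, hb₂⟩ := hdom (α₀ + 2 * ε) ⟨by linarith, h2⟩ T
  refine ⟨ε, hε, fun α hα => ⟨by linarith [hα.1], by linarith [hα.2]⟩,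
    fun x => (1 + 2 / ε) * (g₁ x + g₂ x), (hg₁.add hg₂).const_mul _, fun t ht => ?_⟩
  filter_upwards [hz, hb₁ t ht, hb₂ t ht] with x hx h1 h2 α hα
  have hA := abs_nonneg (A t x)
  have hsum : (z x ^ (α₀ - 2 * ε) + z x ^ (α₀ + 2 * ε)) * |A t x| ≤ g₁ x + g₂ x := by
    rw [add_mul]; exact add_le_add h1 h2
  have hpos : 0 ≤ (z x ^ (α₀ - 2 * ε) + z x ^ (α₀ + 2 * ε)) * |A t x| := by positivity
  have hε' : 0 < 2 / ε := by positivity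
  constructor
  · rw [Real.norm_eq_abs, abs_mul, abs_of_pos (Real.rpow_pos_of_pos hx α)]
    have := mul_le_mul_of_nonneg_right (rpow_le_rpow_add_rpow hx (a := α₀ - 2 * ε)
      (b := α₀ + 2 * ε) (γ := α) (by linarith [hα.1]) (by linarith [hα.2])) hA
    nlinarith
  · rw [Real.norm_eq_abs, abs_mul]
    have := mul_le_mul_of_nonneg_right (rpow_mul_log_bound hx hε hα) hA
    nlinarith

/-- Derivative of `α ↦ ∫ z ^ α A dν`. -/
lemma hasDerivAt_integral_rpow (hzm : Measurable z) (hz : ∀ᵐ x ∂ν, 0 < z x)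
    (hA : ∀ t, Measurable (A t))
    (hdom : ∀ a ∈ Set.Ioo lo hi, ∀ T : ℝ, ∃ g : X → ℝ, Integrable g ν ∧
      ∀ t ∈ Set.Icc 0 T, ∀ᵐ x ∂ν, z x ^ a * |A t x| ≤ g x)
    {α₀ t : ℝ} (hα₀ : α₀ ∈ Set.Ioo lo hi) (ht : 0 ≤ t) :
    HasDerivAt (fun α => ∫ x, z x ^ α * A t x ∂ν)
      (∫ x, z x ^ α₀ * Real.log (z x) * A t x ∂ν) α₀ := by
  obtain ⟨ε, hε, -, g, hg, hb⟩ := exists_integrable_bound hz hdom hα₀ t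
  have hmem : α₀ ∈ Set.Ioo (α₀ - ε) (α₀ + ε) := ⟨by linarith, by linarith⟩
  have hbt := hb t ⟨ht, le_rfl⟩
  have hAt := hA t
  refine (hasDerivAt_integral_of_dominated_loc_of_deriv_le (bound := g)
    (F := fun α x => z x ^ α * A t x) (F' := fun α x => z x ^ α * Real.log (z x) * A t x)
    (s := Set.Ioo (α₀ - ε) (α₀ + ε)) (isOpen_Ioo.mem_nhds hmem) ?_ ?_ ?_ ?_ hg ?_).2
  · exact Eventually.of_forall fun α => (by fun_prop : Measurable _).aestronglyMeasurable
  · refine hg.mono' (by fun_prop : Measurable _).aestronglyMeasurable ?_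
    filter_upwards [hbt] with x hx using (hx α₀ hmem).1
  · exact (by fun_prop : Measurable _).aestronglyMeasurable
  · filter_upwards [hbt] with x hx α hα using (hx α hα).2
  · filter_upwards [hz] with x hx α _
    exact (Real.hasStrictDerivAt_const_rpow hx α).hasDerivAt.mul_const _

/-- Joint continuity of `(α, t) ↦ ∫ z ^ α A_t dν` and of its derivative in `α`. -/
lemma continuousOn_integral_rpow (hzm : Measurable z) (hz : ∀ᵐ x ∂ν, 0 < z x)
    (hA : ∀ t, Measurable (A t)) (hcont : ∀ t, ∀ᵐ x ∂ν, ContinuousAt (fun s => A s x) t)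
    (hdom : ∀ a ∈ Set.Ioo lo hi, ∀ T : ℝ, ∃ g : X → ℝ, Integrable g ν ∧
      ∀ t ∈ Set.Icc 0 T, ∀ᵐ x ∂ν, z x ^ a * |A t x| ≤ g x) :
    ContinuousOn (fun p : ℝ × ℝ => ∫ x, z x ^ p.1 * A p.2 x ∂ν) (Set.Ioo lo hi ×ˢ Set.Ici 0) ∧
    ContinuousOn (fun p : ℝ × ℝ => ∫ x, z x ^ p.1 * Real.log (z x) * A p.2 x ∂ν)
      (Set.Ioo lo hi ×ˢ Set.Ici 0) := by
  rw [ContinuousOn, ContinuousOn, ← forall₂_and]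
  rintro ⟨α₀, t₀⟩ ⟨hα₀, ht₀⟩
  obtain ⟨ε, hε, -, g, hg, hb⟩ := exists_integrable_bound hz hdom hα₀ (t₀ + 1)
  have hev : ∀ᶠ p : ℝ × ℝ in 𝓝[Set.Ioo lo hi ×ˢ Set.Ici 0] (α₀, t₀),
      p.1 ∈ Set.Ioo (α₀ - ε) (α₀ + ε) ∧ p.2 ∈ Set.Icc 0 (t₀ + 1) := by
    have h1 : ∀ᶠ p : ℝ × ℝ in 𝓝 (α₀, t₀), p ∈ Set.Ioo (α₀ - ε) (α₀ + ε) ×ˢ Set.Iio (t₀ + 1) :=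
      (isOpen_Ioo.prod isOpen_Iio).mem_nhds ⟨⟨by simpa using hε, by simpa using hε⟩, by simp⟩
    filter_upwards [nhdsWithin_le_nhds h1, self_mem_nhdsWithin] with p hp hp'
    exact ⟨hp.1, hp'.2, le_of_lt hp.2⟩
  constructor
  · refine continuousWithinAt_of_dominated (bound := g) ?_ ?_ hg ?_
    · refine Eventually.of_forall fun p => ?_
      have := hA p.2
      exact (by fun_prop : Measurable _).aestronglyMeasurable
    · filter_upwards [hev] with p hp
      filter_upwards [hb p.2 hp.2] with x hx using (hx p.1 hp.1).1
    · filter_upwards [hz, hcont t₀] with x hx hc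
      refine ContinuousAt.continuousWithinAt ?_
      have h1 : ContinuousAt (fun p : ℝ × ℝ => z x ^ p.1) (α₀, t₀) :=
        (Real.continuousAt_const_rpow hx.ne').comp continuousAt_fst
      have h2 : ContinuousAt (fun p : ℝ × ℝ => A p.2 x) (α₀, t₀) :=
        ContinuousAt.comp (f := Prod.snd) (g := fun s => A s x) hc continuousAt_snd
      exact h1.mul h2
  · refine continuousWithinAt_of_dominated (bound := g) ?_ ?_ hg ?_
    · refine Eventually.of_forall fun p => ?_
      have := hA p.2
      exact (by fun_prop : Measurable _).aestronglyMeasurable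
    · filter_upwards [hev] with p hp
      filter_upwards [hb p.2 hp.2] with x hx using (hx p.1 hp.1).2
    · filter_upwards [hz, hcont t₀] with x hx hc
      refine ContinuousAt.continuousWithinAt ?_
      have h1 : ContinuousAt (fun p : ℝ × ℝ => z x ^ p.1) (α₀, t₀) :=
        (Real.continuousAt_const_rpow hx.ne').comp continuousAt_fst
      have h2 : ContinuousAt (fun p : ℝ × ℝ => A p.2 x) (α₀, t₀) :=
        ContinuousAt.comp (f := Prod.snd) (g := fun s => A s x) hc continuousAt_snd
      exact (h1.mul continuousAt_const).mul h2

end ParametricPowers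

/-- The properties of a Brownian path that make its moving averages differentiable in the Hurst
parameter: local Hölder continuity of every order below `1 / 2`, and integrability of the tail. -/
structure IsRegularPath (w : ℝ → ℝ) : Prop where
  continuous : Continuous w
  holder : ∀ β < (1 / 2 : ℝ), ∀ T : ℝ, ∃ C : ℝ, ∀ t ∈ Set.Icc 0 T, ∀ u ∈ Set.Ioo (0 : ℝ) 1,
    |w t - w (t - u)| ≤ C * u ^ β
  tail : ∀ a < (1 / 2 : ℝ), ∀ T : ℝ,
    Integrable (fun p : ℝ × ℝ => p.1 ^ a * farIncrement w T p) farMeasure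

lemma isRegularPath_zero : IsRegularPath 0 where
  continuous := continuous_const
  holder β _ T := ⟨0, by simp⟩
  tail a _ T := by simp [farIncrement]

lemma continuousAt_farIncrement (w : ℝ → ℝ) (t : ℝ) :
    ∀ᵐ p ∂farMeasure, ContinuousAt (fun s => farIncrement w s p) t := by
  have h : ∀ᵐ v ∂(volume.restrict (Set.Ioi (0 : ℝ))), v ≠ t :=
    ae_restrict_of_ae (by simp [ae_iff])
  have h' : ∀ᵐ p ∂farMeasure, p.2 ≠ t := Measure.quasiMeasurePreserving_snd.ae h
  filter_upwards [h'] with p hp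
  refine ContinuousAt.mul ?_ continuousAt_const
  rcases lt_or_gt_of_ne hp with h | h
  · refine continuousAt_const.congr (f := fun _ => (1 : ℝ)) ?_
    filter_upwards [lt_mem_nhds h] with s hs
    simp [hs.le]
  · refine continuousAt_const.congr (f := fun _ => (0 : ℝ)) ?_
    filter_upwards [gt_mem_nhds h] with s hs
    simp [hs]

namespace IsRegularPath

variable {w : ℝ → ℝ} (hw : IsRegularPath w)

include hw

lemma measurable_near (t : ℝ) : Measurable (nearIncrement w t) := by
  have := hw.continuous.measurable
  unfold nearIncrement
  fun_prop

lemma measurable_far (t : ℝ) : Measurable (farIncrement w t) := by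
  have := hw.continuous.measurable
  have h : Measurable fun p : ℝ × ℝ => (Set.Iic t).indicator (fun _ => (1 : ℝ)) p.2 :=
    (measurable_const.indicator measurableSet_Iic).comp measurable_snd
  unfold farIncrement
  fun_prop

lemma continuousAt_near (t : ℝ) :
    ∀ᵐ u ∂nearMeasure, ContinuousAt (fun s => nearIncrement w s u) t := by
  refine Eventually.of_forall fun u => ?_
  have := hw.continuous
  unfold nearIncrement
  fun_prop

lemma near_bound : ∀ a ∈ Set.Ioo (-(1 / 2) : ℝ) (1 / 2), ∀ T : ℝ, ∃ g : ℝ → ℝ,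
    Integrable g nearMeasure ∧
      ∀ t ∈ Set.Icc 0 T, ∀ᵐ u ∂nearMeasure, u ^ a * |nearIncrement w t u| ≤ g u := by
  intro a ha T
  -- any Hölder exponent `β` with `-a < β < 1 / 2` makes `u ^ (a - 1 + β)` integrable at zero
  obtain ⟨β, hβ1, hβ2⟩ : ∃ β, -a < β ∧ β < 1 / 2 := exists_between (by linarith [ha.1])
  obtain ⟨C, hC⟩ := hw.holder β hβ2 T
  refine ⟨fun u => C * u ^ (a - 1 + β), ?_, fun t ht => ?_⟩
  · have := (intervalIntegral.intervalIntegrable_rpow' (a := 0) (b := 1) (r := a - 1 + β)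
      (by linarith)).1
    exact (this.mono_set Set.Ioo_subset_Ioc_self).const_mul C
  · filter_upwards [ae_restrict_mem measurableSet_Ioo] with u hu
    have h1 := hC t ht u hu
    have hu0 := hu.1
    rw [nearIncrement, abs_mul, abs_of_pos (inv_pos.2 hu0), abs_of_pos hu0, Real.rpow_add hu0,
      Real.rpow_sub_one hu0.ne']
    calc u ^ a * (u⁻¹ * |w t - w (t - u)|) ≤ u ^ a * (u⁻¹ * (C * u ^ β)) := by gcongr
      _ = _ := by ring

lemma far_bound : ∀ a ∈ Set.Ioo (-(1 / 2) : ℝ) (1 / 2), ∀ T : ℝ, ∃ g : ℝ × ℝ → ℝ,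
    Integrable g farMeasure ∧
      ∀ t ∈ Set.Icc 0 T, ∀ᵐ p ∂farMeasure, p.1 ^ a * |farIncrement w t p| ≤ g p := by
  intro a ha T
  refine ⟨_, (hw.tail a ha.2 T).norm, fun t ht => ?_⟩
  filter_upwards [ae_farMeasure] with p hp
  have h0 : 0 < p.1 := by linarith [hp.1]
  rw [norm_mul, Real.norm_of_nonneg (Real.rpow_nonneg h0.le a), Real.norm_eq_abs]
  refine mul_le_mul_of_nonneg_left ?_ (Real.rpow_nonneg h0.le a)
  rw [farIncrement, farIncrement, abs_mul, abs_mul ((Set.Iic T).indicator _ _)]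
  refine mul_le_mul_of_nonneg_right ?_ (abs_nonneg _)
  by_cases h : p.2 ≤ t
  · simp [h, le_trans h ht.2]
  · simp [h]

end IsRegularPath

/-- The derivative of `mvnPath w α t` in `α`. -/
noncomputable def mvnPathDeriv (w : ℝ → ℝ) (α t : ℝ) : ℝ :=
  (((∫ u, u ^ α * nearIncrement w 0 u ∂nearMeasure)
      - ∫ u, u ^ α * nearIncrement w t u ∂nearMeasure)
    + α * ((∫ u, u ^ α * Real.log u * nearIncrement w 0 u ∂nearMeasure)
      - ∫ u, u ^ α * Real.log u * nearIncrement w t u ∂nearMeasure))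
    + ((1 - 2 * α) * ∫ p, p.1 ^ α * farIncrement w t p ∂farMeasure)
    + α * (1 - α) * ∫ p, p.1 ^ α * Real.log p.1 * farIncrement w t p ∂farMeasure

namespace IsRegularPath

variable {w : ℝ → ℝ} (hw : IsRegularPath w)

include hw

lemma hasDerivAt_mvnPath {α t : ℝ} (hα : α ∈ Set.Ioo (-(1 / 2) : ℝ) (1 / 2)) (ht : 0 ≤ t) :
    HasDerivAt (fun α => mvnPath w α t) (mvnPathDeriv w α t) α := by
  have hz : ∀ᵐ u ∂nearMeasure, 0 < u := by
    filter_upwards [ae_restrict_mem measurableSet_Ioo] with u hu using hu.1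
  have hz' : ∀ᵐ p ∂farMeasure, 0 < p.1 := by
    filter_upwards [ae_farMeasure] with p hp using one_pos.trans hp.1
  have h0 := hasDerivAt_integral_rpow (z := fun u => u) measurable_id hz hw.measurable_near
    hw.near_bound hα le_rfl
  have h1 := hasDerivAt_integral_rpow (z := fun u => u) measurable_id hz hw.measurable_near
    hw.near_bound hα ht
  have h2 := hasDerivAt_integral_rpow measurable_fst hz' hw.measurable_far hw.far_bound hα ht
  have hid := hasDerivAt_id α
  have hα2 : HasDerivAt (fun α : ℝ => α * (1 - α)) (1 - 2 * α) α := by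
    refine (hid.mul (hid.const_sub 1)).congr_deriv ?_
    simp only [id]
    ring
  have h := (((hid.mul (h0.sub h1)).const_add (w t - w 0)).add (hα2.mul h2))
  refine h.congr_deriv ?_
  simp only [mvnPathDeriv, id, Pi.sub_apply]
  ring

lemma continuousOn_mvnPath :
    ContinuousOn (fun p : ℝ × ℝ => mvnPath w p.1 p.2)
      (Set.Ioo (-(1 / 2)) (1 / 2) ×ˢ Set.Ici 0) ∧
    ContinuousOn (fun p : ℝ × ℝ => mvnPathDeriv w p.1 p.2)
      (Set.Ioo (-(1 / 2)) (1 / 2) ×ˢ Set.Ici 0) := by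
  have hz : ∀ᵐ u ∂nearMeasure, 0 < u := by
    filter_upwards [ae_restrict_mem measurableSet_Ioo] with u hu using hu.1
  have hz' : ∀ᵐ p ∂farMeasure, 0 < p.1 := by
    filter_upwards [ae_farMeasure] with p hp using one_pos.trans hp.1
  obtain ⟨h1, h1'⟩ := continuousOn_integral_rpow (z := fun u => u) measurable_id hz
    hw.measurable_near hw.continuousAt_near hw.near_bound
  obtain ⟨h2, h2'⟩ := continuousOn_integral_rpow measurable_fst hz' hw.measurable_far
    (continuousAt_farIncrement w) hw.far_bound
  have hm : ContinuousOn (fun p : ℝ × ℝ => (p.1, (0 : ℝ)))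
      (Set.Ioo (-(1 / 2) : ℝ) (1 / 2) ×ˢ Set.Ici 0) := by fun_prop
  have hmaps : Set.MapsTo (fun p : ℝ × ℝ => (p.1, (0 : ℝ)))
      (Set.Ioo (-(1 / 2) : ℝ) (1 / 2) ×ˢ Set.Ici 0)
      (Set.Ioo (-(1 / 2) : ℝ) (1 / 2) ×ˢ Set.Ici 0) := fun p hp => ⟨hp.1, Set.self_mem_Ici⟩
  have h0 := h1.comp hm hmaps
  have h0' := h1'.comp hm hmaps
  simp only [Function.comp_def] at h0 h0'
  have hwc := hw.continuous
  have hW : ContinuousOn (fun p : ℝ × ℝ => w p.2 - w 0)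
      (Set.Ioo (-(1 / 2) : ℝ) (1 / 2) ×ˢ Set.Ici 0) := by fun_prop
  unfold mvnPath mvnPathDeriv
  constructor <;> fun_prop

end IsRegularPath

/-! ### Dyadic chaining -/

/-- Hölder continuity of a continuous function from its increments along dyadic intervals. -/
lemma holder_of_dyadic_increments {f : ℝ → ℝ} (hf : Continuous f) {γ C : ℝ} (hγ : 0 < γ)
    {N : ℕ} (hC : ∀ (n : ℕ) (k : ℤ), -((N : ℝ) * 2 ^ n) ≤ k → (k : ℝ) < N * 2 ^ n →
      |f ((k + 1) / 2 ^ n) - f (k / 2 ^ n)| ≤ C * ((1 / 2 : ℝ) ^ γ) ^ n) :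
    ∃ K : ℝ, ∀ s ∈ Set.Ico (-N : ℝ) N, ∀ t ∈ Set.Ico (-N : ℝ) N, s < t → t ≤ s + 1 →
      |f t - f s| ≤ K * (t - s) ^ γ := by
  set r : ℝ := (1 / 2 : ℝ) ^ γ with hr
  have hr0 : 0 < r := by positivity
  have hr1 : r < 1 := Real.rpow_lt_one (by norm_num) (by norm_num) hγ
  have hfl : ∀ (n : ℕ), ∀ t ∈ Set.Ico (-N : ℝ) N, -((N : ℝ) * 2 ^ n) ≤ ⌊t * 2 ^ n⌋ ∧
      ((⌊t * 2 ^ n⌋ : ℤ) : ℝ) < N * 2 ^ n := by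
    intro n t ht
    have h2 : (0 : ℝ) < 2 ^ n := by positivity
    constructor
    · have h : -((N : ℤ) * 2 ^ n) ≤ ⌊t * 2 ^ n⌋ := by
        rw [Int.le_floor]
        push_cast
        nlinarith [ht.1]
      exact_mod_cast h
    · exact (Int.floor_le _).trans_lt (by nlinarith [ht.2])
  -- `f` at a point is approximated by `f` at its dyadic approximations from below
  have happ : ∀ t ∈ Set.Ico (-N : ℝ) N, ∀ n : ℕ,
      |f (⌊t * 2 ^ n⌋ / 2 ^ n) - f t| ≤ C * r ^ n / (1 - r) := by
    intro t ht n
    have hC0 : 0 ≤ C := by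
      have h := hC 0 _ (hfl 0 t ht).1 (hfl 0 t ht).2
      simp only [pow_zero, mul_one] at h
      exact (abs_nonneg _).trans h
    refine dist_le_of_le_geometric_of_tendsto (f := fun n : ℕ => f (⌊t * 2 ^ n⌋ / 2 ^ n)) r C hr1
      (fun n => ?_) ?_ n
    · have h2 : (0 : ℝ) < 2 ^ n := by positivity
      have h2' : (0 : ℝ) < 2 ^ (n + 1) := by positivity
      have hfloor : ⌊t * 2 ^ (n + 1)⌋ = 2 * ⌊t * 2 ^ n⌋ ∨
          ⌊t * 2 ^ (n + 1)⌋ = 2 * ⌊t * 2 ^ n⌋ + 1 := by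
        have e : t * 2 ^ (n + 1) = 2 * (t * 2 ^ n) := by ring
        have h3 := Int.floor_le (t * 2 ^ n)
        have h4 := Int.lt_floor_add_one (t * 2 ^ n)
        have h5 : 2 * ⌊t * 2 ^ n⌋ ≤ ⌊t * 2 ^ (n + 1)⌋ := by
          rw [Int.le_floor, e]; push_cast; linarith
        have h6 : ⌊t * 2 ^ (n + 1)⌋ < 2 * ⌊t * 2 ^ n⌋ + 2 := by
          rw [Int.floor_lt, e]; push_cast; linarith
        omega
      have hpt : ((2 * ⌊t * 2 ^ n⌋ : ℤ) : ℝ) / 2 ^ (n + 1) = ⌊t * 2 ^ n⌋ / 2 ^ n := by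
        rw [pow_succ]; push_cast; field_simp
      rw [dist_comm, Real.dist_eq]
      rcases hfloor with h | h
      · rw [h, hpt, sub_self, abs_zero]
        positivity
      · rw [h, ← hpt]
        have h7 := hC (n + 1) (2 * ⌊t * 2 ^ n⌋) ?_ ?_
        · rw [Int.cast_add, Int.cast_one]
          refine h7.trans ?_
          gcongr ?_ * ?_
          exact pow_le_pow_of_le_one hr0.le hr1.le (Nat.le_succ n)
        · have := (hfl n t ht).1
          rw [pow_succ]; push_cast; linarith
        · have := (hfl n t ht).2
          rw [pow_succ]; push_cast; linarith
    · refine (hf.tendsto t).comp ?_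
      refine tendsto_of_tendsto_of_tendsto_of_le_of_le (g := fun n : ℕ => t - (1 / 2 : ℝ) ^ n)
        (h := fun _ => t) ?_ tendsto_const_nhds (fun n => ?_) (fun n => ?_)
      · simpa using (tendsto_pow_atTop_nhds_zero_of_lt_one (r := (1 / 2 : ℝ)) (by norm_num)
          (by norm_num)).const_sub t
      · have h2 : (0 : ℝ) < 2 ^ n := by positivity
        simp only
        rw [le_div_iff₀ h2, sub_mul, ← mul_pow]
        norm_num
        linarith [Int.lt_floor_add_one (t * 2 ^ n)]
      · have h2 : (0 : ℝ) < 2 ^ n := by positivity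
        simp only
        rw [div_le_iff₀ h2]
        exact Int.floor_le _
  refine ⟨(2 * (C / (1 - r)) + C) * 2 ^ γ, fun s hs t ht hst hts => ?_⟩
  obtain ⟨n, hn1, hn2⟩ := exists_nat_pow_near_of_lt_one (x := t - s) (y := (1 / 2 : ℝ))
    (by linarith) (by linarith) (by norm_num) (by norm_num)
  have h2 : (0 : ℝ) < 2 ^ n := by positivity
  have hC0 : 0 ≤ C := by
    have h := hC 0 _ (hfl 0 t ht).1 (hfl 0 t ht).2
    simp only [pow_zero, mul_one] at h
    exact (abs_nonneg _).trans h
  have hmid : |f (⌊t * 2 ^ n⌋ / 2 ^ n) - f (⌊s * 2 ^ n⌋ / 2 ^ n)| ≤ C * r ^ n := by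
    have h3 : ⌊s * 2 ^ n⌋ ≤ ⌊t * 2 ^ n⌋ := Int.floor_le_floor (by nlinarith)
    have h4 : ⌊t * 2 ^ n⌋ ≤ ⌊s * 2 ^ n⌋ + 1 := by
      rw [← Int.floor_add_one]
      refine Int.floor_le_floor ?_
      have : (1 / 2 : ℝ) ^ n * 2 ^ n = 1 := by rw [← mul_pow]; norm_num
      nlinarith
    rcases (by omega : ⌊t * 2 ^ n⌋ = ⌊s * 2 ^ n⌋ ∨ ⌊t * 2 ^ n⌋ = ⌊s * 2 ^ n⌋ + 1) with h | h
    · rw [h, sub_self, abs_zero]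
      positivity
    · rw [h, Int.cast_add, Int.cast_one]
      exact hC n _ (hfl n s hs).1 (hfl n s hs).2
  have hrn : r ^ n ≤ 2 ^ γ * (t - s) ^ γ := by
    rw [← Real.mul_rpow (by norm_num) (by linarith), hr, ← Real.rpow_natCast, ← Real.rpow_mul
      (by norm_num), mul_comm γ, Real.rpow_mul (by norm_num), Real.rpow_natCast]
    refine Real.rpow_le_rpow (by positivity) ?_ hγ.le
    rw [pow_succ] at hn1
    linarith
  have h5 := happ t ht n
  have h6 := happ s hs n
  have hsum : |f t - f s| ≤ (2 * (C / (1 - r)) + C) * r ^ n := by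
    rw [abs_le] at *
    have e : C * r ^ n / (1 - r) = C / (1 - r) * r ^ n := by ring
    rw [e] at h5 h6
    constructor <;> linarith [h5.1, h5.2, h6.1, h6.2, hmid.1, hmid.2]
  refine hsum.trans ?_
  rw [mul_assoc]
  refine mul_le_mul_of_nonneg_left hrn ?_
  have : 0 < 1 - r := by linarith
  positivity

/-- Moments of Gaussian variables scale like powers of the variance. -/
lemma exists_lintegral_rpow_gaussianReal_le {p : ℝ} (hp : 0 < p) : ∃ M : ℝ≥0, ∀ v : ℝ≥0,
    ∫⁻ x, ‖x‖ₑ ^ p ∂(gaussianReal 0 v) ≤ M * (v : ℝ≥0∞) ^ (p / 2) := by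
  have hfin : ∫⁻ x, ‖x‖ₑ ^ p ∂(gaussianReal 0 1) < ∞ := by
    have h := (memLp_id_gaussianReal' (μ := 0) (v := 1) (ENNReal.ofReal p) (by simp)).2
    rw [eLpNorm_lt_top_iff_lintegral_rpow_enorm_lt_top (by simpa using hp) (by simp),
      ENNReal.toReal_ofReal hp.le] at h
    exact h
  refine ⟨(∫⁻ x, ‖x‖ₑ ^ p ∂(gaussianReal 0 1)).toNNReal, fun v => ?_⟩
  rw [ENNReal.coe_toNNReal hfin.ne]
  have hmap : gaussianReal 0 v = (gaussianReal 0 1).map (fun x => √v * x) := by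
    rw [gaussianReal_map_const_mul]
    congr 1
    · simp
    · ext
      simp
  rw [hmap, lintegral_map (by fun_prop) (by fun_prop)]
  simp only [enorm_mul, ENNReal.mul_rpow_of_nonneg _ _ hp.le]
  rw [lintegral_const_mul _ (by fun_prop), mul_comm]
  gcongr
  rw [Real.enorm_of_nonneg (Real.sqrt_nonneg _), Real.sqrt_eq_rpow,
    ← ENNReal.ofReal_rpow_of_nonneg (by simp) (by norm_num), ← ENNReal.rpow_mul,
    ENNReal.ofReal_coe_nnreal]
  exact le_of_eq (by congr 1; ring)

/-- The increments of `V` between times of equal sign have moments of the size of those of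
Brownian motion. -/
def HasBrownianMoments {Ω : Type*} [MeasurableSpace Ω] (V : ℝ → Ω → ℝ) (P : Measure Ω) : Prop :=
  ∀ p : ℝ, 0 < p → ∃ M : ℝ≥0, ∀ s t : ℝ, 0 ≤ s * t →
    ∫⁻ ω, ‖V s ω - V t ω‖ₑ ^ p ∂P ≤ M * ENNReal.ofReal |s - t| ^ (p / 2)

section

variable {Ω : Type*} [MeasurableSpace Ω] {P : Measure Ω} {V : ℝ → Ω → ℝ}

/-- The `p`-th powers of the rescaled dyadic increments on `[-N, N]` have an almost surely finite
sum: for `p = 2 / (1 / 2 - γ)` the contribution of level `n` has mean of order `2 ^ (-n)`. -/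
lemma ae_dyadic_increments_le (hV : HasBrownianMoments V P) (hVm : ∀ t, Measurable (V t))
    {γ : ℝ} (hγ2 : γ < 1 / 2) (N : ℕ) :
    ∀ᵐ ω ∂P, ∃ C : ℝ, ∀ (n : ℕ) (k : ℤ), -((N : ℝ) * 2 ^ n) ≤ k → (k : ℝ) < N * 2 ^ n →
      |V ((k + 1) / 2 ^ n) ω - V (k / 2 ^ n) ω| ≤ C * ((1 / 2 : ℝ) ^ γ) ^ n := by
  set p : ℝ := 2 / (1 / 2 - γ) with hp
  have hγ' : 0 < 1 / 2 - γ := by linarith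
  have hp0 : 0 < p := by positivity
  obtain ⟨M, hM⟩ := hV p hp0
  set r : ℝ := (1 / 2 : ℝ) ^ γ with hr
  have hr0 : 0 < r := by positivity
  let X : ℕ → ℤ → Ω → ℝ≥0∞ := fun n k ω =>
    ‖(r ^ n)⁻¹ * (V ((k + 1) / 2 ^ n) ω - V (k / 2 ^ n) ω)‖ₑ ^ p
  have hXm : ∀ n k, Measurable (X n k) := fun n k => by
    have h1 := hVm ((k + 1) / 2 ^ n)
    have h2 := hVm (k / 2 ^ n)
    fun_prop
  have hX : ∀ n k, ∫⁻ ω, X n k ω ∂P ≤ M * ENNReal.ofReal ((1 / 2 : ℝ) ^ n * (1 / 2) ^ n) := by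
    intro n k
    simp only [X, enorm_mul, ENNReal.mul_rpow_of_nonneg _ _ hp0.le]
    have hm : Measurable fun ω => ‖V ((k + 1) / 2 ^ n) ω - V (k / 2 ^ n) ω‖ₑ ^ p := by
      have h1 := hVm ((k + 1) / 2 ^ n)
      have h2 := hVm (k / 2 ^ n)
      fun_prop
    rw [lintegral_const_mul _ hm]
    have hsign : (0 : ℝ) ≤ (k + 1) / 2 ^ n * (k / 2 ^ n) := by
      have hk : (0 : ℤ) ≤ (k + 1) * k := by
        rcases le_or_gt 0 k with h | h
        · positivity
        · exact mul_nonneg_of_nonpos_of_nonpos (by omega) h.le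
      have hk' : (0 : ℝ) ≤ (k + 1) * k := by exact_mod_cast hk
      rw [div_mul_div_comm]
      positivity
    refine (mul_le_mul_right (hM _ _ hsign) _).trans (le_of_eq ?_)
    have e1 : |((k : ℝ) + 1) / 2 ^ n - k / 2 ^ n| = (1 / 2 : ℝ) ^ n := by
      rw [← sub_div, add_sub_cancel_left, abs_of_pos (by positivity), one_div, one_div, inv_pow]
    rw [e1, mul_left_comm, Real.enorm_of_nonneg (by positivity),
      ENNReal.ofReal_rpow_of_nonneg (by positivity) hp0.le,
      ENNReal.ofReal_rpow_of_nonneg (by positivity) (by positivity),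
      ← ENNReal.ofReal_mul (by positivity)]
    congr 2
    have e2 : (r ^ n)⁻¹ = ((1 / 2 : ℝ) ^ n) ^ (-γ) := by
      rw [hr, ← Real.rpow_natCast, ← Real.rpow_natCast, ← Real.rpow_mul (by norm_num),
        ← Real.rpow_mul (by norm_num), ← Real.rpow_neg (by norm_num)]
      congr 1
      ring
    rw [e2, ← Real.rpow_mul (by positivity), ← Real.rpow_add (by positivity), ← sq,
      ← Real.rpow_natCast _ 2]
    congr 1
    have : p * (1 / 2 - γ) = 2 := by rw [hp, div_mul_cancel₀ _ hγ'.ne']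
    push_cast
    linarith
  let I : ℕ → Finset ℤ := fun n => Finset.Ico (-((N : ℤ) * 2 ^ n)) (N * 2 ^ n)
  have hcard : ∀ n, ((I n).card : ℝ≥0∞) = ENNReal.ofReal (2 * N * 2 ^ n) := by
    intro n
    have : (I n).card = 2 * N * 2 ^ n := by
      simp only [I, Int.card_Ico]
      have : ((N : ℤ) * 2 ^ n - -((N : ℤ) * 2 ^ n)) = ((2 * N * 2 ^ n : ℕ) : ℤ) := by
        push_cast; ring
      rw [this, Int.toNat_natCast]
    rw [this, ← ENNReal.ofReal_natCast]
    push_cast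
    rfl
  have hfin : ∫⁻ ω, ∑' n, ∑ k ∈ I n, X n k ω ∂P ≠ ∞ := by
    rw [lintegral_tsum fun n => (Finset.measurable_sum _ fun k _ => hXm n k).aemeasurable]
    have hle : ∀ n, ∫⁻ ω, ∑ k ∈ I n, X n k ω ∂P
        ≤ M * ENNReal.ofReal (2 * N) * ENNReal.ofReal ((1 / 2 : ℝ) ^ n) := by
      intro n
      rw [lintegral_finsetSum _ fun k _ => hXm n k]
      refine (Finset.sum_le_card_nsmul _ _ _ fun k _ => hX n k).trans (le_of_eq ?_)
      rw [nsmul_eq_mul, hcard, mul_left_comm, ← ENNReal.ofReal_mul (by positivity),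
        mul_assoc (M : ℝ≥0∞), ← ENNReal.ofReal_mul (by positivity)]
      congr 2
      have : (1 / 2 : ℝ) ^ n * 2 ^ n = 1 := by rw [← mul_pow]; norm_num
      linear_combination 2 * N * (1 / 2 : ℝ) ^ n * this
    refine ne_top_of_le_ne_top ?_ (ENNReal.tsum_le_tsum hle)
    rw [ENNReal.tsum_mul_left]
    refine ENNReal.mul_ne_top (ENNReal.mul_ne_top ENNReal.coe_ne_top ENNReal.ofReal_ne_top) ?_
    rw [← ENNReal.ofReal_tsum_of_nonneg (fun n => by positivity) summable_geometric_two]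
    exact ENNReal.ofReal_ne_top
  have hmeas : Measurable fun ω => ∑' n, ∑ k ∈ I n, X n k ω :=
    Measurable.tsum fun n => Finset.measurable_sum _ fun k _ => hXm n k
  filter_upwards [ae_lt_top hmeas hfin] with ω hω
  set Z := ∑' n, ∑ k ∈ I n, X n k ω with hZ
  refine ⟨(Z ^ (1 / p)).toReal, fun n k hk1 hk2 => ?_⟩
  have hkI : k ∈ I n := by
    simp only [I, Finset.mem_Ico]
    exact ⟨by exact_mod_cast hk1, by exact_mod_cast hk2⟩
  have h1 : X n k ω ≤ Z :=
    (Finset.single_le_sum (f := fun k => X n k ω) (fun _ _ => zero_le) hkI).trans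
      (ENNReal.le_tsum n)
  have h2 : ‖(r ^ n)⁻¹ * (V ((k + 1) / 2 ^ n) ω - V (k / 2 ^ n) ω)‖ₑ ≤ Z ^ (1 / p) := by
    rw [one_div, ENNReal.le_rpow_inv_iff hp0]
    exact h1
  have h3 : Z ^ (1 / p) ≠ ∞ := ENNReal.rpow_ne_top_of_nonneg (by positivity) hω.ne
  have h4 := ENNReal.toReal_mono h3 h2
  rw [toReal_enorm, norm_mul, Real.norm_of_nonneg (by positivity), Real.norm_eq_abs,
    inv_mul_le_iff₀ (by positivity)] at h4
  rw [mul_comm]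
  exact h4

end

/-! ### Regularity of Brownian paths -/

lemma integral_brownianIndicator_mul (s t : ℝ) :
    ∫ x, brownianIndicator s x * brownianIndicator t x
      = if 0 ≤ s ∧ 0 ≤ t then min s t else if s < 0 ∧ t < 0 then min (-s) (-t) else 0 := by
  have hind : ∀ a b : ℝ, a ≤ b → ∫ x, (Set.Ioc a b).indicator (fun _ => (1 : ℝ)) x = b - a := by
    intro a b hab
    rw [integral_indicator measurableSet_Ioc]
    simp [hab]
  split_ifs with h1 h2
  · rw [← sub_zero (min s t), ← hind 0 (min s t) (le_min h1.1 h1.2)]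
    congr 1
    ext x
    simp only [brownianIndicator, Set.indicator_apply, Set.mem_Ioc]
    grind
  · have e : min (-s) (-t) = 0 - max s t := by grind
    rw [e, ← hind (max s t) 0 (max_le h2.1.le h2.2.le)]
    congr 1
    ext x
    simp only [brownianIndicator, Set.indicator_apply, Set.mem_Ioc]
    grind
  · rw [← integral_zero ℝ ℝ]
    congr 1
    ext x
    simp only [brownianIndicator, Set.indicator_apply, Set.mem_Ioc]
    grind

section

variable {Ω : Type*} [MeasurableSpace Ω] {P : Measure Ω} {V W : ℝ → Ω → ℝ}

lemma HasBrownianCovariance.congr (hV : HasBrownianCovariance V P)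
    (h : ∀ t, V t =ᵐ[P] W t) : HasBrownianCovariance W P where
  memLp t := (hV.memLp t).ae_eq (h t)
  covariance s t := by
    rw [← hV.covariance]
    refine integral_congr_ae ?_
    filter_upwards [h s, h t] with ω h1 h2
    rw [h1, h2]

lemma HasBrownianMoments.congr (hV : HasBrownianMoments V P)
    (h : ∀ t, V t =ᵐ[P] W t) : HasBrownianMoments W P := by
  intro p hp
  obtain ⟨M, hM⟩ := hV p hp
  refine ⟨M, fun s t hst => (lintegral_congr_ae ?_).trans_le (hM s t hst)⟩
  filter_upwards [h s, h t] with ω h1 h2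
  rw [h1, h2]

lemma IsWienerIntegral.congr_integrator {f : ℝ → ℝ} {Y : Ω → ℝ} (hY : IsWienerIntegral V P f Y)
    (h : ∀ t, V t =ᵐ[P] W t) : IsWienerIntegral W P f Y := by
  obtain ⟨h1, h2, φ, h3, h4⟩ := hY
  refine ⟨h1, h2, φ, h3, h4.congr fun k => eLpNorm_congr_ae ?_⟩
  have h5 : ∀ᵐ ω ∂P, ∀ i, V ((φ k).right i) ω = W ((φ k).right i) ω ∧
      V ((φ k).left i) ω = W ((φ k).left i) ω :=
    ae_all_iff.2 fun i => (h _).and (h _)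
  filter_upwards [h5] with ω hω
  simp only [StepIntegrand.integral, hω]

lemma IsTwoSidedBM.hasBrownianCovariance [IsProbabilityMeasure P] (hW : IsTwoSidedBM W P) :
    HasBrownianCovariance W P := by
  obtain ⟨W₁, W₂, h₁, h₂, hind, hpos, hneg⟩ := hW
  have hL : ∀ {B : ℝ≥0 → Ω → ℝ}, IsBrownianReal B P → ∀ t, MemLp (B t) 2 P := fun hB t =>
    (hB.isGaussianProcess.hasGaussianLaw_eval t).memLp_two
  have hcov : ∀ {B : ℝ≥0 → Ω → ℝ}, IsBrownianReal B P → ∀ s t,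
      ∫ ω, B s ω * B t ω ∂P = min (s : ℝ) t := by
    intro B hB s t
    have h := hB.covariance_eval s t
    rw [covariance_eq_sub (hL hB s) (hL hB t), hB.integral_eval s, zero_mul, sub_zero] at h
    simpa using h
  have hmix : ∀ s t, ∫ ω, W₁ s ω * W₂ t ω ∂P = 0 := by
    intro s t
    have hi : IndepFun (W₁ s) (W₂ t) P :=
      hind.comp (φ := fun f : ℝ≥0 → ℝ => f s) (ψ := fun f : ℝ≥0 → ℝ => f t)
        (measurable_pi_apply s) (measurable_pi_apply t)
    rw [hi.integral_fun_mul_eq_mul_integral (hL h₁ s).1 (hL h₂ t).1, h₁.integral_eval s, zero_mul]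
  refine ⟨fun t => ?_, fun s t => ?_⟩
  · rcases le_or_gt 0 t with h | h
    · rw [hpos t h]; exact hL h₁ _
    · rw [hneg t h]; exact hL h₂ _
  · rw [integral_brownianIndicator_mul]
    rcases le_or_gt 0 s with hs | hs <;> rcases le_or_gt 0 t with ht | ht
    · rw [hpos s hs, hpos t ht, hcov h₁, if_pos ⟨hs, ht⟩, Real.coe_toNNReal _ hs,
        Real.coe_toNNReal _ ht]
    · rw [hpos s hs, hneg t ht, hmix, if_neg (by grind), if_neg (by grind)]
    · rw [hneg s hs, hpos t ht, if_neg (by grind), if_neg (by grind)]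
      simp only [mul_comm (W₂ _ _)]
      exact hmix _ _
    · rw [hneg s hs, hneg t ht, hcov h₂, if_neg (by grind), if_pos ⟨hs, ht⟩,
        Real.coe_toNNReal _ (by linarith), Real.coe_toNNReal _ (by linarith)]

lemma IsTwoSidedBM.ae_continuous (hW : IsTwoSidedBM W P) :
    ∀ᵐ ω ∂P, Continuous fun t => W t ω := by
  obtain ⟨W₁, W₂, h₁, h₂, -, hpos, hneg⟩ := hW
  filter_upwards [h₁.eval_zero_ae_eq_zero, h₂.eval_zero_ae_eq_zero, h₁.cont, h₂.cont]
    with ω h10 h20 hc1 hc2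
  have e : (fun t => W t ω) = fun t : ℝ => W₁ t.toNNReal ω + W₂ (-t).toNNReal ω := by
    funext t
    rcases le_or_gt 0 t with h | h
    · rw [hpos t h, Real.toNNReal_of_nonpos (by linarith : -t ≤ 0), h20, add_zero]
    · rw [hneg t h, Real.toNNReal_of_nonpos h.le, h10, zero_add]
  rw [e]
  exact (hc1.comp continuous_real_toNNReal).add
    (hc2.comp (continuous_real_toNNReal.comp continuous_neg))

lemma IsTwoSidedBM.hasBrownianMoments (hW : IsTwoSidedBM W P) : HasBrownianMoments W P := by
  intro p hp
  obtain ⟨M, hM⟩ := exists_lintegral_rpow_gaussianReal_le hp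
  obtain ⟨W₁, W₂, h₁, h₂, -, hpos, hneg⟩ := hW
  have hB : ∀ {B : ℝ≥0 → Ω → ℝ}, IsBrownianReal B P → ∀ s t : ℝ, 0 ≤ s → 0 ≤ t →
      ∫⁻ ω, ‖B s.toNNReal ω - B t.toNNReal ω‖ₑ ^ p ∂P ≤ M * ENNReal.ofReal |s - t| ^ (p / 2) := by
    intro B hB s t hs ht
    have h := (hB.hasLaw_sub s.toNNReal t.toNNReal).lintegral_comp (f := fun x => ‖x‖ₑ ^ p)
      (by fun_prop)
    simp only [Pi.sub_apply] at h
    rw [h]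
    refine (hM _).trans (le_of_eq ?_)
    congr 2
    rw [NNReal.val_eq_coe, NNReal.val_eq_coe, Real.coe_toNNReal _ hs, Real.coe_toNNReal _ ht,
      ← Real.dist_eq, ← edist_dist, edist_nndist]
  have hzero : W₁ 0 =ᵐ[P] W₂ 0 := by
    filter_upwards [h₁.eval_zero_ae_eq_zero, h₂.eval_zero_ae_eq_zero] with ω h1 h2
    rw [h1, h2]
  -- at time zero the two one-sided motions agree almost surely
  have hneg' : ∀ t ≤ 0, W t =ᵐ[P] W₂ (-t).toNNReal := by
    intro t ht
    rcases ht.lt_or_eq with h | h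
    · rw [hneg t h]
    · subst h
      rw [hpos 0 le_rfl]
      simpa using hzero
  refine ⟨M, fun s t hst => ?_⟩
  rcases mul_nonneg_iff.1 hst with ⟨hs, ht⟩ | ⟨hs, ht⟩
  · rw [hpos s hs, hpos t ht]
    exact hB h₁ s t hs ht
  · have h := hB h₂ (-s) (-t) (by linarith) (by linarith)
    rw [show -s - -t = -(s - t) by ring, abs_neg] at h
    refine (lintegral_congr_ae ?_).trans_le h
    filter_upwards [hneg' s hs, hneg' t ht] with ω h1 h2
    rw [h1, h2]

/-- A process whose paths almost surely have a property `Q`, satisfied by the zero path and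
implying continuity, has an indistinguishable measurable version all of whose paths satisfy `Q`. -/
lemma exists_indistinguishable_version {Q : (ℝ → ℝ) → Prop} (hQ0 : Q 0)
    (hQc : ∀ w, Q w → Continuous w) (hm : ∀ t, AEMeasurable (V t) P)
    (hQ : ∀ᵐ ω ∂P, Q fun t => V t ω) :
    ∃ V' : ℝ → Ω → ℝ, (∀ t, Measurable (V' t)) ∧ (∀ ω, Q fun t => V' t ω) ∧
      ∀ᵐ ω ∂P, ∀ t, V t ω = V' t ω := by
  classical
  have hq : ∀ᵐ ω ∂P, ∀ q : ℚ, V q ω = (hm q).mk (V q) ω := ae_all_iff.2 fun q => (hm q).ae_eq_mk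
  obtain ⟨N, hN, hNm, hN0⟩ := exists_measurable_superset_of_null (ae_iff.1 (hQ.and hq))
  have hgood : ∀ ω ∉ N, (Q fun t => V t ω) ∧ ∀ q : ℚ, V q ω = (hm q).mk (V q) ω := by
    intro ω hω
    by_contra h
    exact hω (hN h)
  have hQ' : ∀ ω, Q fun t => Nᶜ.indicator (V t) ω := by
    intro ω
    by_cases hω : ω ∈ N
    · have : (fun t => Nᶜ.indicator (V t) ω) = 0 := by
        funext t
        simp [hω]
      rwa [this]
    · have : (fun t => Nᶜ.indicator (V t) ω) = fun t => V t ω := by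
        funext t
        simp [hω]
      rw [this]
      exact (hgood ω hω).1
  refine ⟨fun t => Nᶜ.indicator (V t), fun t => ?_, hQ', ?_⟩
  · have hrat : ∀ q : ℚ, Measurable (Nᶜ.indicator (V q)) := by
      intro q
      have : Nᶜ.indicator (V q) = Nᶜ.indicator ((hm q).mk (V q)) := by
        funext ω
        by_cases hω : ω ∈ N
        · simp [hω]
        · simpa [hω] using (hgood ω hω).2 q
      rw [this]
      exact (hm q).measurable_mk.indicator hNm.compl
    obtain ⟨x, hx, hlim⟩ := mem_closure_iff_seq_limit.1 (Rat.denseRange_cast (𝕜 := ℝ) t)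
    choose q hqx using hx
    refine measurable_of_tendsto_metrizable (f := fun n => Nᶜ.indicator (V (q n)))
      (fun n => hrat (q n)) (tendsto_pi_nhds.2 fun ω => ?_)
    have := ((hQc _ (hQ' ω)).tendsto t).comp hlim
    refine this.congr fun n => ?_
    simp only [Function.comp, ← hqx]
  · have : ∀ᵐ ω ∂P, ω ∉ N := by
      rw [ae_iff]
      simpa using hN0
    filter_upwards [this] with ω hω t
    simp [hω]

/-- Almost every path of Brownian motion is regular. -/
lemma ae_isRegularPath [IsProbabilityMeasure P] (hV : HasBrownianCovariance V P)
    (hVM : HasBrownianMoments V P) (hVm : ∀ t, Measurable (V t))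
    (hVc : ∀ ω, Continuous fun t => V t ω) : ∀ᵐ ω ∂P, IsRegularPath fun t => V t ω := by
  have hVu : Measurable (Function.uncurry V) :=
    measurable_uncurry_of_continuous_of_measurable hVc hVm
  have hβlt : ∀ n : ℕ, (1 / 2 : ℝ) - 1 / ((n : ℝ) + 3) < 1 / 2 := fun n => by
    have : (0 : ℝ) < 1 / ((n : ℝ) + 3) := by positivity
    linarith
  have hβpos : ∀ n : ℕ, 0 < (1 / 2 : ℝ) - 1 / ((n : ℝ) + 3) := fun n => by
    have : 1 / ((n : ℝ) + 3) < 1 / 2 := by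
      apply one_div_lt_one_div_of_lt (by norm_num)
      have : (0 : ℝ) ≤ n := n.cast_nonneg
      linarith
    linarith
  have hβex : ∀ β < (1 / 2 : ℝ), ∃ n : ℕ, β ≤ (1 / 2 : ℝ) - 1 / ((n : ℝ) + 3) := by
    intro β hβ
    obtain ⟨n, hn⟩ := exists_nat_one_div_lt (sub_pos.2 hβ)
    refine ⟨n, ?_⟩
    have : 1 / ((n : ℝ) + 3) ≤ 1 / ((n : ℝ) + 1) := by
      apply one_div_le_one_div_of_le (by positivity)
      linarith
    linarith
  have h1 : ∀ᵐ ω ∂P, ∀ n N : ℕ, ∃ C : ℝ, ∀ (m : ℕ) (k : ℤ), -((N : ℝ) * 2 ^ m) ≤ k →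
      (k : ℝ) < N * 2 ^ m → |V ((k + 1) / 2 ^ m) ω - V (k / 2 ^ m) ω|
        ≤ C * ((1 / 2 : ℝ) ^ ((1 / 2 : ℝ) - 1 / ((n : ℝ) + 3))) ^ m :=
    ae_all_iff.2 fun n => ae_all_iff.2 fun N => ae_dyadic_increments_le hVM hVm (hβlt n) N
  have h2 : ∀ᵐ ω ∂P, ∀ n N : ℕ, Integrable (fun p : ℝ × ℝ => p.1 ^ ((1 / 2 : ℝ) -
      1 / ((n : ℝ) + 3)) * farIncrement (fun t => V t ω) N p) farMeasure := by
    refine ae_all_iff.2 fun n => ae_all_iff.2 fun N => ?_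
    have h := ae_integrable_increments hV hVu (ν := farMeasure) (l := fun p => p.2 - max p.1 1)
      (r := fun p => p.2 - 1) (measurable_far_coef ((1 / 2 : ℝ) - 1 / ((n : ℝ) + 3)) N)
      (by fun_prop) (by fun_prop) (fun p => sub_le_sub_left (le_max_right _ _) _)
      (integrable_far_sqrt (hβlt n) N)
    simpa only [farIncrement, mul_assoc] using h
  filter_upwards [h1, h2] with ω hω1 hω2
  refine ⟨hVc ω, fun β hβ T => ?_, fun a ha T => ?_⟩
  · obtain ⟨n, hn⟩ := hβex β hβ
    obtain ⟨N, hN⟩ := exists_nat_ge T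
    obtain ⟨C, hC⟩ := hω1 n (N + 1)
    obtain ⟨K, hK⟩ := holder_of_dyadic_increments (hVc ω) (hβpos n) hC
    refine ⟨|K|, fun t ht u hu => ?_⟩
    push_cast at hK
    have h := hK (t - u) ⟨by linarith [ht.1, hu.2, N.cast_nonneg (α := ℝ)],
        by linarith [ht.2, hu.1]⟩ t
      ⟨by linarith [ht.1, N.cast_nonneg (α := ℝ)], by linarith [ht.2]⟩ (by linarith [hu.1])
      (by linarith [hu.2])
    rw [sub_sub_cancel] at h
    refine h.trans ?_
    have hu0 := hu.1
    exact mul_le_mul (le_abs_self K) (Real.rpow_le_rpow_of_exponent_ge hu.1 hu.2.le hn)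
      (by positivity) (abs_nonneg K)
  · obtain ⟨n, hn⟩ := hβex a ha
    obtain ⟨N, hN⟩ := exists_nat_ge T
    refine (hω2 n N).mono ?_ ?_
    · have hw : Measurable fun t => V t ω := (hVc ω).measurable
      have h : Measurable fun p : ℝ × ℝ => (Set.Iic T).indicator (fun _ => (1 : ℝ)) p.2 :=
        (measurable_const.indicator measurableSet_Iic).comp measurable_snd
      unfold farIncrement
      exact (by fun_prop : Measurable _).aestronglyMeasurable
    · filter_upwards [ae_farMeasure] with p hp
      have h0 : 0 < p.1 := by linarith [hp.1]
      rw [norm_mul, norm_mul, Real.norm_of_nonneg (Real.rpow_nonneg h0.le _),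
        Real.norm_of_nonneg (Real.rpow_nonneg h0.le _)]
      refine mul_le_mul (Real.rpow_le_rpow_of_exponent_le hp.1.le hn) ?_ (norm_nonneg _)
        (Real.rpow_nonneg h0.le _)
      rw [farIncrement, farIncrement, norm_mul, norm_mul ((Set.Iic (N : ℝ)).indicator _ _)]
      refine mul_le_mul_of_nonneg_right ?_ (norm_nonneg _)
      by_cases h : p.2 ≤ T
      · simp [h, le_trans h hN]
      · simp [h]

/-- Two-sided Brownian motion has an indistinguishable measurable version with regular paths. -/
lemma IsTwoSidedBM.exists_regular_version [IsProbabilityMeasure P] (hW : IsTwoSidedBM W P) :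
    ∃ V : ℝ → Ω → ℝ, (∀ t, Measurable (V t)) ∧ (∀ ω, IsRegularPath fun t => V t ω) ∧
      ∀ t, W t =ᵐ[P] V t := by
  obtain ⟨V, hVm, hVc, hWV⟩ := exists_indistinguishable_version (Q := Continuous)
    continuous_const (fun _ h => h) (fun t => (hW.hasBrownianCovariance.memLp t).1.aemeasurable)
    hW.ae_continuous
  have hWV' : ∀ t, W t =ᵐ[P] V t := fun t => by
    filter_upwards [hWV] with ω h using h t
  have hreg := ae_isRegularPath (hW.hasBrownianCovariance.congr hWV')
    (hW.hasBrownianMoments.congr hWV') hVm hVc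
  obtain ⟨V', hV'm, hV'r, hVV'⟩ := exists_indistinguishable_version (Q := IsRegularPath)
    isRegularPath_zero (fun _ h => h.continuous) (fun t => (hVm t).aemeasurable) hreg
  refine ⟨V', hV'm, hV'r, fun t => (hWV' t).trans ?_⟩
  filter_upwards [hVV'] with ω h using h t

end

/-! ### The differentiable version of fractional Brownian motion and the stability estimate -/

lemma Real.contDiffAt_Gamma_of_pos {x : ℝ} (hx : 0 < x) : ContDiffAt ℝ 1 Real.Gamma x := by
  have hopen : IsOpen {z : ℂ | 0 < z.re} := isOpen_lt continuous_const Complex.continuous_re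
  have hd : DifferentiableOn ℂ Complex.Gamma {z : ℂ | 0 < z.re} := by
    intro z hz
    refine (Complex.differentiableAt_Gamma z fun m h => ?_).differentiableWithinAt
    have h1 : 0 < z.re := hz
    rw [h, Complex.neg_re, Complex.natCast_re] at h1
    linarith [(Nat.cast_nonneg m : (0 : ℝ) ≤ m)]
  have hc : ContDiffAt ℂ 1 Complex.Gamma (x : ℂ) :=
    (hd.contDiffOn hopen).contDiffAt (hopen.mem_nhds (by simpa using hx))
  refine hc.real_of_complex.congr_of_eventuallyEq (Eventually.of_forall fun y => ?_)
  simp only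
  rw [Complex.Gamma_ofReal, Complex.ofReal_re]

lemma contDiffOn_mvnConst : ContDiffOn ℝ 1 mvnConst (Set.Ioo 0 1) := by
  intro H hH
  refine ContDiffAt.contDiffWithinAt ?_
  have h1 : 0 < 2 * H + 1 := by linarith [hH.1]
  have h2 : 0 < H + 1 / 2 := by linarith [hH.1]
  have hsin : 0 < Real.sin (Real.pi * H) :=
    Real.sin_pos_of_pos_of_lt_pi (mul_pos Real.pi_pos hH.1)
      (by nlinarith [Real.pi_pos, hH.2])
  have hG1 : ContDiffAt ℝ 1 (fun H : ℝ => Real.Gamma (2 * H + 1)) H :=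
    ContDiffAt.comp (g := Real.Gamma) (f := fun H : ℝ => 2 * H + 1) H
      (Real.contDiffAt_Gamma_of_pos h1) (by fun_prop)
  have hG2 : ContDiffAt ℝ 1 (fun H : ℝ => Real.Gamma (H + 1 / 2)) H :=
    ContDiffAt.comp (g := Real.Gamma) (f := fun H : ℝ => H + 1 / 2) H
      (Real.contDiffAt_Gamma_of_pos h2) (by fun_prop)
  have hs : ContDiffAt ℝ 1 (fun H : ℝ => Real.sin (Real.pi * H)) H := by fun_prop
  have hpos : 0 < Real.sin (Real.pi * H) * Real.Gamma (2 * H + 1) :=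
    mul_pos hsin (Real.Gamma_pos_of_pos h1)
  exact ((hs.mul hG1).sqrt hpos.ne').div hG2 (Real.Gamma_pos_of_pos h2).ne'

section

variable {Ω : Type*} [MeasurableSpace Ω] {V : ℝ → Ω → ℝ}

lemma measurable_uncurry_nearIncrement (hV : Measurable (Function.uncurry V)) (t : ℝ) :
    Measurable fun q : Ω × ℝ => nearIncrement (fun s => V s q.1) t q.2 := by
  have h1 : Measurable fun q : Ω × ℝ => V t q.1 :=
    hV.comp (measurable_const.prodMk measurable_fst)
  have h2 : Measurable fun q : Ω × ℝ => V (t - |q.2|) q.1 :=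
    hV.comp (Measurable.prodMk (by fun_prop) measurable_fst)
  unfold nearIncrement
  fun_prop

lemma measurable_uncurry_farIncrement (hV : Measurable (Function.uncurry V)) (t : ℝ) :
    Measurable fun q : Ω × (ℝ × ℝ) => farIncrement (fun s => V s q.1) t q.2 := by
  have h1 : Measurable fun q : Ω × (ℝ × ℝ) => V (q.2.2 - 1) q.1 :=
    hV.comp (Measurable.prodMk (by fun_prop) measurable_fst)
  have h2 : Measurable fun q : Ω × (ℝ × ℝ) => V (q.2.2 - max q.2.1 1) q.1 :=
    hV.comp (Measurable.prodMk (by fun_prop) measurable_fst)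
  have h : Measurable fun q : Ω × (ℝ × ℝ) => (Set.Iic t).indicator (fun _ => (1 : ℝ)) q.2.2 :=
    (measurable_const.indicator measurableSet_Iic).comp (measurable_snd.comp measurable_snd)
  unfold farIncrement
  fun_prop

lemma measurable_integral_near (hV : Measurable (Function.uncurry V)) {c : ℝ → ℝ}
    (hc : Measurable c) (t : ℝ) :
    Measurable fun ω => ∫ u, c u * nearIncrement (fun s => V s ω) t u ∂nearMeasure :=
  (StronglyMeasurable.integral_prod_right
    (f := fun ω u => c u * nearIncrement (fun s => V s ω) t u)
    ((hc.comp measurable_snd).mul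
      (measurable_uncurry_nearIncrement hV t)).stronglyMeasurable).measurable

lemma measurable_integral_far (hV : Measurable (Function.uncurry V)) {c : ℝ × ℝ → ℝ}
    (hc : Measurable c) (t : ℝ) :
    Measurable fun ω => ∫ p, c p * farIncrement (fun s => V s ω) t p ∂farMeasure :=
  (StronglyMeasurable.integral_prod_right
    (f := fun ω p => c p * farIncrement (fun s => V s ω) t p)
    ((hc.comp measurable_snd).mul
      (measurable_uncurry_farIncrement hV t)).stronglyMeasurable).measurable

lemma measurable_mvnPath (hV : Measurable (Function.uncurry V)) (α t : ℝ) :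
    Measurable fun ω => mvnPath (fun s => V s ω) α t := by
  have h0 := measurable_integral_near hV (c := fun u => u ^ α) (by fun_prop) 0
  have h1 := measurable_integral_near hV (c := fun u => u ^ α) (by fun_prop) t
  have h2 := measurable_integral_far hV (c := fun p => p.1 ^ α) (by fun_prop) t
  have h3 : ∀ s, Measurable (V s) := fun s => hV.comp (measurable_const.prodMk measurable_id)
  have h4 := h3 t
  have h5 := h3 0
  unfold mvnPath
  fun_prop

lemma measurable_mvnPathDeriv (hV : Measurable (Function.uncurry V)) (α t : ℝ) :
    Measurable fun ω => mvnPathDeriv (fun s => V s ω) α t := by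
  have h0 := measurable_integral_near hV (c := fun u => u ^ α) (by fun_prop) 0
  have h1 := measurable_integral_near hV (c := fun u => u ^ α) (by fun_prop) t
  have h2 := measurable_integral_far hV (c := fun p => p.1 ^ α) (by fun_prop) t
  have h0' := measurable_integral_near hV (c := fun u => u ^ α * Real.log u) (by fun_prop) 0
  have h1' := measurable_integral_near hV (c := fun u => u ^ α * Real.log u) (by fun_prop) t
  have h2' := measurable_integral_far hV (c := fun p => p.1 ^ α * Real.log p.1) (by fun_prop) t
  unfold mvnPathDeriv
  fun_prop

end

/-- The vector with components `C_H ∫ K_H(s, t) dw^j_s`, for the paths `w^j` of `V`. -/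
noncomputable def mvnField {Ω : Type*} {m : ℕ} (V : Fin m → ℝ → Ω → ℝ) (H t : ℝ) (ω : Ω) :
    EuclideanSpace ℝ (Fin m) :=
  WithLp.toLp 2 fun j => mvnConst H * mvnPath (fun s => V j s ω) (H - 1 / 2) t

/-- The derivative of `mvnField V H t ω` in the Hurst parameter `H`. -/
noncomputable def mvnFieldDeriv {Ω : Type*} {m : ℕ} (V : Fin m → ℝ → Ω → ℝ) (H t : ℝ) (ω : Ω) :
    EuclideanSpace ℝ (Fin m) :=
  WithLp.toLp 2 fun j => deriv mvnConst H * mvnPath (fun s => V j s ω) (H - 1 / 2) t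
    + mvnConst H * mvnPathDeriv (fun s => V j s ω) (H - 1 / 2) t

section

variable {Ω : Type*} {m : ℕ} {V : Fin m → ℝ → Ω → ℝ}

lemma measurable_mvnField [MeasurableSpace Ω] (hV : ∀ j, Measurable (Function.uncurry (V j)))
    (H t : ℝ) : Measurable (mvnField V H t) :=
  (WithLp.measurable_toLp 2 _).comp
    (measurable_pi_lambda _ fun j => (measurable_mvnPath (hV j) _ t).const_mul _)

lemma measurable_mvnFieldDeriv [MeasurableSpace Ω]
    (hV : ∀ j, Measurable (Function.uncurry (V j))) (H t : ℝ) :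
    Measurable (mvnFieldDeriv V H t) :=
  (WithLp.measurable_toLp 2 _).comp (measurable_pi_lambda _ fun j =>
    ((measurable_mvnPath (hV j) _ t).const_mul _).add
      ((measurable_mvnPathDeriv (hV j) _ t).const_mul _))

lemma continuousOn_mvnField (hV : ∀ j ω, IsRegularPath fun t => V j t ω) (ω : Ω) :
    ContinuousOn (fun p : ℝ × ℝ => mvnField V p.1 p.2 ω) (Set.Ioo (0 : ℝ) 1 ×ˢ Set.Ici 0) ∧
    ContinuousOn (fun p : ℝ × ℝ => mvnFieldDeriv V p.1 p.2 ω)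
      (Set.Ioo (0 : ℝ) 1 ×ˢ Set.Ici 0) := by
  have hshift : ContinuousOn (fun p : ℝ × ℝ => (p.1 - 1 / 2, p.2))
      (Set.Ioo (0 : ℝ) 1 ×ˢ Set.Ici 0) := by fun_prop
  have hmaps : Set.MapsTo (fun p : ℝ × ℝ => (p.1 - 1 / 2, p.2))
      (Set.Ioo (0 : ℝ) 1 ×ˢ Set.Ici 0) (Set.Ioo (-(1 / 2) : ℝ) (1 / 2) ×ˢ Set.Ici 0) :=
    fun p hp => ⟨⟨by linarith [hp.1.1], by linarith [hp.1.2]⟩, hp.2⟩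
  have hfst : Set.MapsTo (Prod.fst : ℝ × ℝ → ℝ) (Set.Ioo (0 : ℝ) 1 ×ˢ Set.Ici 0)
      (Set.Ioo (0 : ℝ) 1) := fun p hp => hp.1
  have hC : ContinuousOn (fun p : ℝ × ℝ => mvnConst p.1) (Set.Ioo (0 : ℝ) 1 ×ˢ Set.Ici 0) :=
    contDiffOn_mvnConst.continuousOn.comp continuousOn_fst hfst
  have hC' : ContinuousOn (fun p : ℝ × ℝ => deriv mvnConst p.1)
      (Set.Ioo (0 : ℝ) 1 ×ˢ Set.Ici 0) :=
    (contDiffOn_mvnConst.continuousOn_deriv_of_isOpen isOpen_Ioo le_rfl).comp continuousOn_fst hfst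
  have hpath : ∀ j, ContinuousOn (fun p : ℝ × ℝ => mvnPath (fun s => V j s ω) (p.1 - 1 / 2) p.2)
      (Set.Ioo (0 : ℝ) 1 ×ˢ Set.Ici 0) := by
    intro j
    have h := (hV j ω).continuousOn_mvnPath.1.comp hshift hmaps
    exact h
  have hpath' : ∀ j, ContinuousOn
      (fun p : ℝ × ℝ => mvnPathDeriv (fun s => V j s ω) (p.1 - 1 / 2) p.2)
      (Set.Ioo (0 : ℝ) 1 ×ˢ Set.Ici 0) := by
    intro j
    have h := (hV j ω).continuousOn_mvnPath.2.comp hshift hmaps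
    exact h
  constructor
  · exact (PiLp.continuous_toLp 2 _).comp_continuousOn
      (continuousOn_pi.2 fun j => hC.mul (hpath j))
  · exact (PiLp.continuous_toLp 2 _).comp_continuousOn
      (continuousOn_pi.2 fun j => (hC'.mul (hpath j)).add (hC.mul (hpath' j)))

lemma hasDerivAt_mvnField (hV : ∀ j ω, IsRegularPath fun t => V j t ω) {H t : ℝ}
    (hH : H ∈ Set.Ioo (0 : ℝ) 1) (ht : 0 ≤ t) (ω : Ω) :
    HasDerivAt (fun h => mvnField V h t ω) (mvnFieldDeriv V H t ω) H := by
  have h : HasDerivAt (fun h => fun j : Fin m =>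
      mvnConst h * mvnPath (fun s => V j s ω) (h - 1 / 2) t) (fun j =>
      deriv mvnConst H * mvnPath (fun s => V j s ω) (H - 1 / 2) t
      + mvnConst H * mvnPathDeriv (fun s => V j s ω) (H - 1 / 2) t) H := by
    refine hasDerivAt_pi.2 fun j => ?_
    have h1 : HasDerivAt mvnConst (deriv mvnConst H) H :=
      ((contDiffOn_mvnConst.differentiableOn (by norm_num)).differentiableAt
        (isOpen_Ioo.mem_nhds hH)).hasDerivAt
    have h2 : HasDerivAt (fun h => mvnPath (fun s => V j s ω) (h - 1 / 2) t)
        (mvnPathDeriv (fun s => V j s ω) (H - 1 / 2) t) H :=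
      ((hV j ω).hasDerivAt_mvnPath (α := H - 1 / 2)
        ⟨by linarith [hH.1], by linarith [hH.2]⟩ ht).comp_sub_const H (1 / 2)
    exact h1.mul h2
  exact (PiLp.hasFDerivAt_toLp 2 _).comp_hasDerivAt H h

end

/-- The driving Brownian motion has a Mandelbrot–van Ness fractional Brownian motion that is
continuously differentiable in the Hurst parameter, for every `ω`. -/
lemma exists_isMvNfBm_differentiable {Ω : Type*} [MeasurableSpace Ω] {P : Measure Ω}
    [IsProbabilityMeasure P] {m : ℕ} {W : Fin m → ℝ → Ω → ℝ} (hW : ∀ j, IsTwoSidedBM (W j) P) :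
    ∃ B D : ℝ → ℝ → Ω → EuclideanSpace ℝ (Fin m),
      IsMvNfBm W P B ∧
      (∀ ω, ContinuousOn (fun p : ℝ × ℝ => D p.1 p.2 ω)
        (Set.Ioo (0 : ℝ) 1 ×ˢ Set.Ici (0 : ℝ))) ∧
      (∀ H t, Measurable (D H t)) ∧
      ∀ H ∈ Set.Ioo (0 : ℝ) 1, ∀ t : ℝ, 0 ≤ t → ∀ ω,
        HasDerivAt (fun h => B h t ω) (D H t ω) H := by
  choose V hVm hVr hWV using fun j => (hW j).exists_regular_version
  have hVu : ∀ j, Measurable (Function.uncurry (V j)) := fun j =>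
    measurable_uncurry_of_continuous_of_measurable (fun ω => (hVr j ω).continuous) (hVm j)
  have hVcov : ∀ j, HasBrownianCovariance (V j) P := fun j =>
    (hW j).hasBrownianCovariance.congr (hWV j)
  refine ⟨mvnField V, mvnFieldDeriv V, ⟨fun H _ t _ => measurable_mvnField hVu H t, ?_,
    fun ω => (continuousOn_mvnField hVr ω).1⟩, fun ω => (continuousOn_mvnField hVr ω).2,
    measurable_mvnFieldDeriv hVu, fun H hH t ht ω => hasDerivAt_mvnField hVr hH ht ω⟩
  intro H hH t ht j
  exact ⟨fun ω => mvnPath (fun s => V j s ω) (H - 1 / 2) t,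
    (isWienerIntegral_mvnPath (hVcov j) (hVu j) hH ht).congr_integrator fun t => (hWV j t).symm,
    Eventually.of_forall fun _ => rfl⟩

/-- A continuous random field is bounded on a compact rectangle by a random variable. -/
lemma exists_measurable_bound {Ω E : Type*} [MeasurableSpace Ω] [NormedAddCommGroup E]
    [MeasurableSpace E] [BorelSpace E] {D : ℝ → ℝ → Ω → E} {s : Set (ℝ × ℝ)} (hs : IsCompact s)
    (hm : ∀ h t, Measurable (D h t))
    (hc : ∀ ω, ContinuousOn (fun p : ℝ × ℝ => D p.1 p.2 ω) s) :
    ∃ M : Ω → ℝ, Measurable M ∧ (∀ ω, 0 ≤ M ω) ∧ ∀ ω, ∀ p ∈ s, ‖D p.1 p.2 ω‖ ≤ M ω := by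
  obtain ⟨c, hcs, hcc, hsc⟩ := TopologicalSpace.IsSeparable.exists_countable_dense_subset
    (TopologicalSpace.IsSeparable.of_separableSpace s)
  have : Countable c := hcc.to_subtype
  have hfin : ∀ ω, ⨆ q : c, ‖D q.1.1 q.1.2 ω‖ₑ ≠ ∞ := by
    intro ω
    obtain ⟨K, hK⟩ := hs.exists_bound_of_continuousOn (hc ω)
    refine ne_top_of_le_ne_top (ENNReal.ofReal_ne_top (r := K)) (iSup_le fun q => ?_)
    rw [← ofReal_norm]
    exact ENNReal.ofReal_le_ofReal (hK _ (hcs q.2))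
  refine ⟨fun ω => (⨆ q : c, ‖D q.1.1 q.1.2 ω‖ₑ).toReal,
    (Measurable.iSup fun q : c => (hm q.1.1 q.1.2).enorm).ennreal_toReal,
    fun ω => ENNReal.toReal_nonneg, fun ω p hp => ?_⟩
  have hq : ∀ q ∈ c, ‖D q.1 q.2 ω‖ ≤ (⨆ q : c, ‖D q.1.1 q.1.2 ω‖ₑ).toReal := by
    intro q hq
    rw [← toReal_enorm]
    exact ENNReal.toReal_mono (hfin ω) (le_iSup (fun q : c => ‖D q.1.1 q.1.2 ω‖ₑ) ⟨q, hq⟩)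
  have hp' : p ∈ closure c := hsc hp
  exact ContinuousWithinAt.closure_le hp' (((hc ω).norm p hp).mono hcs)
    continuousWithinAt_const hq

/-- Stability of the equation with additive noise with respect to the noise (Gronwall). -/
lemma norm_sub_le_of_isAdditiveSolution {d m : ℕ}
    {μ : EuclideanSpace ℝ (Fin d) → EuclideanSpace ℝ (Fin d)} {L : ℝ≥0} (hμ : LipschitzWith L μ)
    {S : Matrix (Fin d) (Fin m) ℝ} {x₀ : EuclideanSpace ℝ (Fin d)}
    {g₁ g₂ : ℝ → EuclideanSpace ℝ (Fin m)} {x₁ x₂ : ℝ → EuclideanSpace ℝ (Fin d)}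
    (h₁ : IsAdditiveSolution μ S x₀ g₁ x₁) (h₂ : IsAdditiveSolution μ S x₀ g₂ x₂) {T δ : ℝ}
    (hδ : ∀ t ∈ Set.Icc 0 T, ‖Matrix.toEuclideanLin S (g₁ t - g₂ t)‖ ≤ δ) :
    ∀ t ∈ Set.Icc 0 T, ‖x₁ t - x₂ t‖ ≤ Real.exp ((L + 1) * T) * δ := by
  intro t ht
  have hext : ∀ {x : ℝ → EuclideanSpace ℝ (Fin d)}, ContinuousOn x (Set.Ici 0) →
      Continuous fun s => μ (x (max s 0)) := by
    intro x hx
    refine hμ.continuous.comp (hx.comp_continuous (by fun_prop) fun s => ?_)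
    exact le_max_right s 0
  set e : ℝ → EuclideanSpace ℝ (Fin d) := fun s => μ (x₁ (max s 0)) - μ (x₂ (max s 0)) with he
  have hec : Continuous e := (hext h₁.1).sub (hext h₂.1)
  have hdiff : ∀ s, 0 ≤ s →
      x₁ s - x₂ s = (∫ r in (0 : ℝ)..s, e r) + Matrix.toEuclideanLin S (g₁ s - g₂ s) := by
    intro s hs
    have hcongr : ∀ {x : ℝ → EuclideanSpace ℝ (Fin d)},
        ∫ r in (0 : ℝ)..s, μ (x r) = ∫ r in (0 : ℝ)..s, μ (x (max r 0)) := by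
      intro x
      refine intervalIntegral.integral_congr fun r hr => ?_
      rw [Set.uIcc_of_le hs] at hr
      simp only [max_eq_left hr.1]
    rw [he, intervalIntegral.integral_sub ((hext h₁.1).intervalIntegrable _ _)
      ((hext h₂.1).intervalIntegrable _ _), h₁.2 s hs, h₂.2 s hs, hcongr (x := x₁),
      hcongr (x := x₂), map_sub]
    abel
  have hder : ∀ s, HasDerivAt (fun s => ∫ r in (0 : ℝ)..s, e r) (e s) s := fun s =>
    intervalIntegral.integral_hasDerivAt_right (hec.intervalIntegrable _ _)
      hec.aestronglyMeasurable.stronglyMeasurableAtFilter hec.continuousAt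
  have hL : (0 : ℝ) ≤ L := L.2
  have hle : ∀ s ∈ Set.Icc 0 T, ‖x₁ s - x₂ s‖ ≤ ‖∫ r in (0 : ℝ)..s, e r‖ + δ := by
    intro s hs
    rw [hdiff s hs.1]
    exact (norm_add_le _ _).trans (by gcongr; exact hδ s hs)
  have hgron := norm_le_gronwallBound_of_norm_deriv_right_le
    (f := fun s => ∫ r in (0 : ℝ)..s, e r) (f' := e) (δ := 0) (K := L + 1) (ε := (L + 1) * δ)
    (a := 0) (b := T) (fun s _ => (hder s).continuousAt.continuousWithinAt)
    (fun s _ => (hder s).hasDerivWithinAt) (by simp) (fun s hs => ?_) t ht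
  · have hδ0 : 0 ≤ δ := (norm_nonneg _).trans (hδ t ht)
    rw [gronwallBound_of_K_ne_0 (by positivity), sub_zero] at hgron
    simp only [zero_mul, zero_add] at hgron
    rw [mul_div_cancel_left₀ _ (by positivity)] at hgron
    have hexp : Real.exp ((L + 1) * t) ≤ Real.exp ((L + 1) * T) :=
      Real.exp_le_exp.2 (by nlinarith [ht.2])
    nlinarith [hle t ht]
  · have hs' : s ∈ Set.Icc 0 T := ⟨hs.1, hs.2.le⟩
    have h1 : ‖e s‖ ≤ L * ‖x₁ s - x₂ s‖ := by
      simp only [he, max_eq_left hs.1]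
      exact hμ.norm_sub_le _ _
    nlinarith [hle s hs', norm_nonneg (x₁ s - x₂ s)]

/-- Two Mandelbrot–van Ness fractional Brownian motions with the same driving Brownian motion are
indistinguishable. -/
lemma IsMvNfBm.ae_eq {Ω : Type*} [MeasurableSpace Ω] {P : Measure Ω}
    [IsProbabilityMeasure P] {m : ℕ} {W : Fin m → ℝ → Ω → ℝ} (hW : ∀ j, IsTwoSidedBM (W j) P)
    {B B' : ℝ → ℝ → Ω → EuclideanSpace ℝ (Fin m)} (hB : IsMvNfBm W P B)
    (hB' : IsMvNfBm W P B') :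
    ∀ᵐ ω ∂P, ∀ p ∈ Set.Ioo (0 : ℝ) 1 ×ˢ Set.Ici (0 : ℝ), B p.1 p.2 ω = B' p.1 p.2 ω := by
  set s : Set (ℝ × ℝ) := Set.Ioo (0 : ℝ) 1 ×ˢ Set.Ici (0 : ℝ) with hs
  have hfix : ∀ p ∈ s, B p.1 p.2 =ᵐ[P] B' p.1 p.2 := by
    intro p hp
    have hj : ∀ᵐ ω ∂P, ∀ j, B p.1 p.2 ω j = B' p.1 p.2 ω j := by
      refine ae_all_iff.2 fun j => ?_
      obtain ⟨Y, hY, hBY⟩ := hB.eq_integral p.1 hp.1 p.2 hp.2 j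
      obtain ⟨Y', hY', hBY'⟩ := hB'.eq_integral p.1 hp.1 p.2 hp.2 j
      filter_upwards [hBY, hBY', hY.ae_eq (hW j).hasBrownianCovariance hY'] with ω h1 h2 h3
      rw [h1, h2, h3]
    filter_upwards [hj] with ω hω
    ext j
    exact hω j
  obtain ⟨c, hcs, hcc, hsc⟩ := TopologicalSpace.IsSeparable.exists_countable_dense_subset
    (TopologicalSpace.IsSeparable.of_separableSpace s)
  filter_upwards [(ae_ball_iff hcc).2 fun p hp => hfix p (hcs hp)] with ω hω
  exact Set.EqOn.of_subset_closure hω (hB.continuous ω) (hB'.continuous ω) hcs hsc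

/-- Solutions driven by a fractional Brownian motion that is continuously differentiable in the
Hurst parameter are Lipschitz in the Hurst parameter, with a constant that depends neither on the
initial value nor on the chosen solutions. -/
lemma exists_lipschitz_constant {Ω : Type*} [MeasurableSpace Ω] {m : ℕ}
    {B D : ℝ → ℝ → Ω → EuclideanSpace ℝ (Fin m)}
    (hD : ∀ ω, ContinuousOn (fun p : ℝ × ℝ => D p.1 p.2 ω)
      (Set.Ioo (0 : ℝ) 1 ×ˢ Set.Ici (0 : ℝ)))
    (hDm : ∀ H t, Measurable (D H t))
    (hBD : ∀ H ∈ Set.Ioo (0 : ℝ) 1, ∀ t : ℝ, 0 ≤ t → ∀ ω,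
      HasDerivAt (fun h => B h t ω) (D H t ω) H)
    {d : ℕ} {μ : EuclideanSpace ℝ (Fin d) → EuclideanSpace ℝ (Fin d)} {L : ℝ≥0}
    (hμ : LipschitzWith L μ) (S : Matrix (Fin d) (Fin m) ℝ) {a b : ℝ} (T : ℝ) (ha : 0 < a)
    (hb : b < 1) :
    ∃ K : Ω → ℝ, Measurable K ∧ (∀ ω, 0 ≤ K ω) ∧ ∀ ω x₀ x₁ x₂,
      ∀ H₁ ∈ Set.Icc a b, ∀ H₂ ∈ Set.Icc a b,
      IsAdditiveSolution μ S x₀ (fun t => B H₁ t ω) x₁ →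
      IsAdditiveSolution μ S x₀ (fun t => B H₂ t ω) x₂ →
      ∀ t ∈ Set.Icc 0 T, ‖x₁ t - x₂ t‖ ≤ K ω * |H₁ - H₂| := by
  have hsub : Set.Icc a b ×ˢ Set.Icc 0 T ⊆ Set.Ioo (0 : ℝ) 1 ×ˢ Set.Ici (0 : ℝ) :=
    fun p hp => ⟨⟨ha.trans_le hp.1.1, hp.1.2.trans_lt hb⟩, hp.2.1⟩
  obtain ⟨M, hMm, hM0, hM⟩ := exists_measurable_bound (isCompact_Icc.prod isCompact_Icc) hDm
    fun ω => (hD ω).mono hsub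
  set A := LinearMap.toContinuousLinearMap (Matrix.toEuclideanLin S) with hA
  refine ⟨fun ω => Real.exp ((L + 1) * T) * (‖A‖ * M ω), (hMm.const_mul _).const_mul _,
    fun ω => by have := hM0 ω; positivity, fun ω x₀ x₁ x₂ H₁ h₁ H₂ h₂ hx₁ hx₂ => ?_⟩
  have hlip : ∀ t ∈ Set.Icc 0 T, ‖B H₁ t ω - B H₂ t ω‖ ≤ M ω * |H₁ - H₂| := by
    intro t ht
    refine (convex_Icc a b).norm_image_sub_le_of_norm_hasDerivWithin_le
      (f := fun h => B h t ω) (f' := fun h => D h t ω) (fun h hh => ?_) (fun h hh => ?_) h₂ h₁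
    · exact (hBD h (hsub (Set.mk_mem_prod hh ht)).1 t ht.1 ω).hasDerivWithinAt
    · exact hM ω (h, t) ⟨hh, ht⟩
  intro t ht
  refine (norm_sub_le_of_isAdditiveSolution hμ hx₁ hx₂ (T := T) (δ := ‖A‖ * (M ω * |H₁ - H₂|))
    (fun s hs => ?_) t ht).trans (le_of_eq (by ring))
  exact (A.le_opNorm _).trans (by gcongr; exact hlip s hs)

theorem mainTheorem1 {Ω : Type*} [MeasurableSpace Ω] (P : Measure Ω) [IsProbabilityMeasure P]
    {m : ℕ} (W : Fin m → ℝ → Ω → ℝ) (hW : IsTwoSidedBMVector W P) :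
    -- the version `B^H = B^{1/2} + ∫_{1/2}^H ∂_h B^h dh`: estimate for every `ω`
    (∃ B D : ℝ → ℝ → Ω → EuclideanSpace ℝ (Fin m),
      IsMvNfBm W P B ∧
      (∀ ω, ContinuousOn (fun p : ℝ × ℝ => D p.1 p.2 ω)
        (Set.Ioo (0 : ℝ) 1 ×ˢ Set.Ici (0 : ℝ))) ∧
      (∀ H ∈ Set.Ioo (0 : ℝ) 1, ∀ t : ℝ, 0 ≤ t → ∀ ω,
        B H t ω = B (1 / 2) t ω + ∫ h in (1 / 2 : ℝ)..H, D h t ω) ∧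
      ∀ (d : ℕ) (μ : EuclideanSpace ℝ (Fin d) → EuclideanSpace ℝ (Fin d)),
        (∃ L : ℝ≥0, LipschitzWith L μ) →
        ∀ (S : Matrix (Fin d) (Fin m) ℝ) (a b T : ℝ), 0 < a → a ≤ b → b < 1 → 0 < T →
        ∃ K : Ω → ℝ, Measurable K ∧ (∀ ω, 0 ≤ K ω) ∧
          ∀ (x₀ : EuclideanSpace ℝ (Fin d)) (X : ℝ → ℝ → Ω → EuclideanSpace ℝ (Fin d)),
            (∀ H ∈ Set.Ioo (0 : ℝ) 1, ∀ ω,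
              IsAdditiveSolution μ S x₀ (fun t => B H t ω) (fun t => X H t ω)) →
            ∀ ω, ∀ H₁ ∈ Set.Icc a b, ∀ H₂ ∈ Set.Icc a b, ∀ t ∈ Set.Icc (0 : ℝ) T,
              ‖X H₁ t ω - X H₂ t ω‖ ≤ K ω * |H₁ - H₂|) ∧
    -- any other version that is continuous in `(H, t)`: estimate for almost every `ω`
    (∀ B : ℝ → ℝ → Ω → EuclideanSpace ℝ (Fin m), IsMvNfBm W P B →
      ∀ (d : ℕ) (μ : EuclideanSpace ℝ (Fin d) → EuclideanSpace ℝ (Fin d)),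
        (∃ L : ℝ≥0, LipschitzWith L μ) →
        ∀ (S : Matrix (Fin d) (Fin m) ℝ) (a b T : ℝ), 0 < a → a ≤ b → b < 1 → 0 < T →
        ∃ K : Ω → ℝ, Measurable K ∧ (∀ ω, 0 ≤ K ω) ∧
          ∀ (x₀ : EuclideanSpace ℝ (Fin d)) (X : ℝ → ℝ → Ω → EuclideanSpace ℝ (Fin d)),
            (∀ H ∈ Set.Ioo (0 : ℝ) 1, ∀ ω,
              IsAdditiveSolution μ S x₀ (fun t => B H t ω) (fun t => X H t ω)) →
            ∀ᵐ ω ∂P, ∀ H₁ ∈ Set.Icc a b, ∀ H₂ ∈ Set.Icc a b, ∀ t ∈ Set.Icc (0 : ℝ) T,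
              ‖X H₁ t ω - X H₂ t ω‖ ≤ K ω * |H₁ - H₂|) := by
  obtain ⟨B, D, hB, hD, hDm, hBD⟩ := exists_isMvNfBm_differentiable hW.isBM
  refine ⟨⟨B, D, hB, hD, ?_, ?_⟩, ?_⟩
  · intro H hH t ht ω
    have hsub : Set.uIcc (1 / 2) H ⊆ Set.Ioo (0 : ℝ) 1 :=
      (Set.ordConnected_Ioo).uIcc_subset (by norm_num) hH
    have hcont : ContinuousOn (fun h => D h t ω) (Set.uIcc (1 / 2) H) :=
      (hD ω).comp (f := fun h : ℝ => (h, t)) (by fun_prop) fun h hh => ⟨hsub hh, ht⟩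
    rw [intervalIntegral.integral_eq_sub_of_hasDerivAt (f := fun h => B h t ω)
      (fun h hh => hBD h (hsub hh) t ht ω) hcont.intervalIntegrable]
    abel
  · rintro d μ ⟨L, hμ⟩ S a b T ha hab hb hT
    obtain ⟨K, hKm, hK0, hK⟩ := exists_lipschitz_constant hD hDm hBD hμ S T ha hb
    refine ⟨K, hKm, hK0, fun x₀ X hX ω H₁ h₁ H₂ h₂ => ?_⟩
    exact hK ω x₀ (fun t => X H₁ t ω) (fun t => X H₂ t ω) H₁ h₁ H₂ h₂
      (hX H₁ ⟨ha.trans_le h₁.1, h₁.2.trans_lt hb⟩ ω) (hX H₂ ⟨ha.trans_le h₂.1, h₂.2.trans_lt hb⟩ ω)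
  · rintro B' hB' d μ ⟨L, hμ⟩ S a b T ha hab hb hT
    obtain ⟨K, hKm, hK0, hK⟩ := exists_lipschitz_constant hD hDm hBD hμ S T ha hb
    refine ⟨K, hKm, hK0, fun x₀ X hX => ?_⟩
    filter_upwards [hB'.ae_eq hW.isBM hB] with ω hω H₁ h₁ H₂ h₂
    have hsol : ∀ H ∈ Set.Icc a b,
        IsAdditiveSolution μ S x₀ (fun t => B H t ω) (fun t => X H t ω) := by
      intro H hH
      have hH' : H ∈ Set.Ioo (0 : ℝ) 1 := ⟨ha.trans_le hH.1, hH.2.trans_lt hb⟩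
      refine ⟨(hX H hH' ω).1, fun t ht => ?_⟩
      have h := (hX H hH' ω).2 t ht
      have hBB : B' H t ω = B H t ω := hω (H, t) ⟨hH', ht⟩
      simp only [hBB] at h
      exact h
    exact hK ω x₀ (fun t => X H₁ t ω) (fun t => X H₂ t ω) H₁ h₁ H₂ h₂ (hsol H₁ h₁) (hsol H₂ h₂)
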